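/- Let $p$ be a prime, $d\ge 1$ an integer, $\mathbb{C}_p$ the completion of an algebraic closure of $\mathbb{Q}_p$, and let $\psi:(\mathbb{Q}_p,+)\to\mathbb{C}_p^\times$ be a non-trivial smooth character (a homomorphism with open kernel). Let $\mathcal{H}$ be the Heisenberg group: the set of $[a,b,t]$ with $a,b\in\mathbb{Q}_p^d$, $t\in\mathbb{Q}_p$, and multiplication $$[a_1,b_1,t_1][a_2,b_2,t_2]=\bigl[a_1+a_2,\;b_1+b_2,\;t_1+t_2+\tfrac12(a_1\cdot b_2-b_1\cdot a_2)\bigr].$$ Let $\mathcal{S}=\mathcal{S}(\mathbb{Q}_p^d)$ be the space of locally constant, compactly supported functions $\mathbb{Q}_p^d\to\mathbb{C}_p$, on which $\mathcal{H}$ acts by the Schrödinger representation $$(\rho_\psi([a,b,t])f)(x)=\psi\bigl(t+\tfrac12 a\cdot b+b\cdot x\bigr)\,f(x+a).$$ A norm on $\mathcal{S}$ is a function $\|\cdot\|:\mathcal{S}\to\mathbb{R}_{\ge0}$ that vanishes only at $0$ and satisfies $\|cf\|=|c|_p\|f\|$ and $\|f+g\|\le\max(\|f\|,\|g\|)$;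 it is $\mathcal{H}$-invariant if $\|\rho_\psi(h)f\|=\|f\|$ for all $h\in\mathcal{H}$, $f\in\mathcal{S}$; and it is dominated by $\|\cdot\|'$ if $\|\cdot\|\le D\|\cdot\|'$ for some constant $D>0$. The group $\mathrm{Sp}_{2d}(\mathbb{Q}_p)$ acts on $\mathcal{H}$ from the right by $[w,t]\cdot g=[wg,t]$, where $w=(a,b)$ is a row vector. An intertwining operator attached to $g\in\mathrm{Sp}_{2d}(\mathbb{Q}_p)$ is an invertible linear operator $T_g$ on $\mathcal{S}$ with $\rho_\psi(h)\circ T_g=T_g\circ\rho_\psi(h\cdot g)$ for all $h\in\mathcal{H}$ (by the Stone–von Neumann theorem it exists and is unique up to a scalar). Let $P\subset\mathrm{Sp}_{2d}(\mathbb{Q}_p)$ be the Siegel parabolic subgroup of matrices with vanishing lower left $d\times d$ block. For a point $\alpha=Pg$ of the Grassmannian $P\backslash\mathrm{Sp}_{2d}(\mathbb{Q}_p)$, let $\|\cdot\|_\alpha$ be the positive multiple of the norm $f\mapsto\sup_{x}|T_g(f)(x)|_p$ that takes the value $1$ at the characteristic function of $\mathbb{Z}_p^d$ (it depends only on $\alpha$).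 **Theorem (Rigidity).** Let $\alpha\in P\backslash\mathrm{Sp}_{2d}(\mathbb{Q}_p)$. If $\|\cdot\|$ is an $\mathcal{H}$-invariant norm on $\mathcal{S}$ that is dominated by $\|\cdot\|_\alpha$, then there is a constant $r>0$ with $\|\cdot\|=r\cdot\|\cdot\|_\alpha$. In particular (the case $\alpha=P$), every $\mathcal{H}$-invariant norm on $\mathcal{S}$ that is dominated by the sup norm is a positive multiple of the sup norm. -/

import Mathlib

open Matrix

/-- The vector space `ℚ_p^d`, with its product topology. -/
abbrev Qpd (p : ℕ) [Fact p.Prime] (d : ℕ) : Type := Fin d → ℚ_[p]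

/-- A smooth `ℂ_p`-valued character of `(ℚ_p, +)`: a homomorphism to `ℂ_p^×` with open kernel
(an additive character with values in a field has nonzero values). -/
structure SmoothCharacter (p : ℕ) [Fact p.Prime] where
  toAddChar : AddChar ℚ_[p] ℂ_[p]
  isOpen_ker : IsOpen {t : ℚ_[p] | toAddChar t = 1}

theorem SmoothCharacter.isLocallyConstant {p : ℕ} [Fact p.Prime] (ψ : SmoothCharacter p) :
    IsLocallyConstant ψ.toAddChar := by
  rw [IsLocallyConstant.iff_exists_open]
  intro x
  refine ⟨(fun y => y - x) ⁻¹' {t : ℚ_[p] | ψ.toAddChar t = 1},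
    ψ.isOpen_ker.preimage (by fun_prop), by simp, ?_⟩
  intro y hy
  have h : ψ.toAddChar (y - x) = 1 := hy
  calc ψ.toAddChar y = ψ.toAddChar ((y - x) + x) := by simp
    _ = ψ.toAddChar x := by rw [AddChar.map_add_eq_mul, h, one_mul]

/-- The Schwartz space `S(ℚ_p^d)` of locally constant, compactly supported functions
`ℚ_p^d → ℂ_p`. -/
noncomputable def Schwartz (p : ℕ) [Fact p.Prime] (d : ℕ) :
    Submodule ℂ_[p] (Qpd p d → ℂ_[p]) where
  carrier := {f | IsLocallyConstant f ∧ HasCompactSupport f}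
  zero_mem' := ⟨IsLocallyConstant.const 0, HasCompactSupport.zero⟩
  add_mem' := fun hf hg => ⟨hf.1.add hg.1, hf.2.add hg.2⟩
  smul_mem' := fun c _ hf => ⟨hf.1.comp (fun z => c • z), hf.2.smul_left (f := fun _ => c)⟩

/-- The closed unit polydisc `ℤ_p^d` in `ℚ_p^d`. -/
def unitPolydisc (p : ℕ) [Fact p.Prime] (d : ℕ) : Set (Qpd p d) := {x | ∀ i, ‖x i‖ ≤ 1}

theorem unitPolydisc_eq (p : ℕ) [Fact p.Prime] (d : ℕ) :
    unitPolydisc p d = Metric.closedBall 0 1 := by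
  ext x
  simp [unitPolydisc, pi_norm_le_iff_of_nonneg]

/-- The characteristic function `1_{ℤ_p^d}` as an element of the Schwartz space. -/
noncomputable def charZp (p : ℕ) [Fact p.Prime] (d : ℕ) : Schwartz p d :=
  ⟨(unitPolydisc p d).indicator 1, by
    have hcl : IsClopen (unitPolydisc p d) := by
      rw [unitPolydisc_eq]
      exact IsUltrametricDist.isClopen_closedBall _ one_ne_zero
    constructor
    · rw [← LocallyConstant.coe_charFn ℂ_[p] hcl]
      exact (LocallyConstant.charFn ℂ_[p] hcl).isLocallyConstant
    · refine HasCompactSupport.intro (K := unitPolydisc p d) ?_ ?_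
      · rw [unitPolydisc_eq]
        exact isCompact_closedBall _ _
      · intro x hx
        exact Set.indicator_of_notMem hx _⟩

/-- The Heisenberg group `H_{2d+1}(ℚ_p)`; the element `⟨a, b, t⟩` is `[w, t]` with
`w = (a, b) ∈ W = ℚ_p^d ⊕ ℚ_p^d`. -/
@[ext] structure Heis (p : ℕ) [Fact p.Prime] (d : ℕ) where
  a : Qpd p d
  b : Qpd p d
  t : ℚ_[p]

namespace Heis

variable {p : ℕ} [Fact p.Prime] {d : ℕ}

/-- `[w₁, t₁] * [w₂, t₂] = [w₁ + w₂, t₁ + t₂ + ω(w₁, w₂) / 2]`, where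
`ω((x₁, y₁), (x₂, y₂)) = x₁ ⬝ y₂ - y₁ ⬝ x₂`. -/
noncomputable instance : Mul (Heis p d) :=
  ⟨fun h k => ⟨h.a + k.a, h.b + k.b, h.t + k.t + (h.a ⬝ᵥ k.b - h.b ⬝ᵥ k.a) / 2⟩⟩

noncomputable instance : One (Heis p d) := ⟨⟨0, 0, 0⟩⟩

noncomputable instance : Inv (Heis p d) := ⟨fun h => ⟨-h.a, -h.b, -h.t⟩⟩

@[simp] theorem mul_a (h k : Heis p d) : (h * k).a = h.a + k.a := rfl
@[simp] theorem mul_b (h k : Heis p d) : (h * k).b = h.b + k.b := rfl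
@[simp] theorem mul_t (h k : Heis p d) :
    (h * k).t = h.t + k.t + (h.a ⬝ᵥ k.b - h.b ⬝ᵥ k.a) / 2 := rfl
@[simp] theorem one_a : (1 : Heis p d).a = 0 := rfl
@[simp] theorem one_b : (1 : Heis p d).b = 0 := rfl
@[simp] theorem one_t : (1 : Heis p d).t = 0 := rfl
@[simp] theorem inv_a (h : Heis p d) : h⁻¹.a = -h.a := rfl
@[simp] theorem inv_b (h : Heis p d) : h⁻¹.b = -h.b := rfl
@[simp] theorem inv_t (h : Heis p d) : h⁻¹.t = -h.t := rfl

noncomputable instance : Group (Heis p d) :=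
  Group.ofLeftAxioms
    (by
      intro x y z
      ext1
      · simp [add_assoc]
      · simp [add_assoc]
      · simp only [mul_a, mul_b, mul_t, add_dotProduct, dotProduct_add]
        ring)
    (by intro x; ext1 <;> simp)
    (by
      intro x
      ext1
      · simp
      · simp
      · simp [dotProduct_comm x.a x.b])

/-- The right action `[w, t] · g = [w g, t]` of `Sp_{2d}(ℚ_p)`, with `w` a row vector. -/
noncomputable def act (h : Heis p d) (g : symplecticGroup (Fin d) ℚ_[p]) : Heis p d where
  a := fun i => (Sum.elim h.a h.b ᵥ* (g : Matrix (Fin d ⊕ Fin d) (Fin d ⊕ Fin d) ℚ_[p])) (Sum.inl i)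
  b := fun i => (Sum.elim h.a h.b ᵥ* (g : Matrix (Fin d ⊕ Fin d) (Fin d ⊕ Fin d) ℚ_[p])) (Sum.inr i)
  t := h.t

end Heis

/-- The function `x ↦ ψ(t + (a ⬝ b) / 2 + b ⬝ x) * f(x + a)`. -/
noncomputable def schrodingerFun {p : ℕ} [Fact p.Prime] {d : ℕ} (ψ : SmoothCharacter p)
    (h : Heis p d) (f : Qpd p d → ℂ_[p]) (x : Qpd p d) : ℂ_[p] :=
  ψ.toAddChar (h.t + (h.a ⬝ᵥ h.b) / 2 + h.b ⬝ᵥ x) * f (x + h.a)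

theorem schrodingerFun_mem {p : ℕ} [Fact p.Prime] {d : ℕ} (ψ : SmoothCharacter p)
    (h : Heis p d) {f : Qpd p d → ℂ_[p]} (hf : f ∈ Schwartz p d) :
    schrodingerFun ψ h f ∈ Schwartz p d := by
  refine ⟨?_, ?_⟩
  · refine IsLocallyConstant.mul ?_ ?_
    · refine ψ.isLocallyConstant.comp_continuous
        (f := fun x : Qpd p d => h.t + (h.a ⬝ᵥ h.b) / 2 + h.b ⬝ᵥ x) ?_
      simp only [dotProduct]
      fun_prop
    · exact hf.1.comp_continuous (f := fun x : Qpd p d => x + h.a) (by fun_prop)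
  · refine HasCompactSupport.mul_left ?_
    exact hf.2.comp_homeomorph (Homeomorph.addRight h.a)

/-- The Schrödinger representation `ρ_ψ` of the Heisenberg group on `S(ℚ_p^d)`. -/
noncomputable def schrodinger {p : ℕ} [Fact p.Prime] (d : ℕ) (ψ : SmoothCharacter p) :
    Representation ℂ_[p] (Heis p d) (Schwartz p d) where
  toFun h :=
    { toFun := fun f => ⟨schrodingerFun ψ h f, schrodingerFun_mem ψ h f.2⟩
      map_add' := by
        intro f g
        ext x
        simp [schrodingerFun, mul_add]
      map_smul' := by
        intro c f
        ext x
        simp [schrodingerFun, mul_left_comm] }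
  map_one' := by
    ext f x
    simp [schrodingerFun]
  map_mul' := by
    intro h k
    ext f x
    simp only [schrodingerFun, LinearMap.coe_mk, AddHom.coe_mk, Module.End.mul_apply]
    rw [← mul_assoc, ← AddChar.map_add_eq_mul]
    congr 2
    · simp only [Heis.mul_a, Heis.mul_b, Heis.mul_t, add_dotProduct, dotProduct_add]
      rw [dotProduct_comm h.b k.a, dotProduct_comm k.b h.a, dotProduct_comm k.a h.b]
      rw [dotProduct_comm h.b k.a]
      ring
    · simp [add_assoc]

/-- `T` is an intertwining operator `T_g` attached to `g ∈ Sp_{2d}(ℚ_p)`: an invertible operator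
on `S(ℚ_p^d)` with `ρ_ψ([w,t]) ∘ T = T ∘ ρ_ψ([w,t] · g)`. -/
def IsIntertwining {p : ℕ} [Fact p.Prime] {d : ℕ} (ψ : SmoothCharacter p)
    (g : symplecticGroup (Fin d) ℚ_[p]) (T : Schwartz p d ≃ₗ[ℂ_[p]] Schwartz p d) : Prop :=
  ∀ (h : Heis p d) (f : Schwartz p d),
    schrodinger d ψ h (T f) = T (schrodinger d ψ (h.act g) f)

/-- The Siegel parabolic subgroup `P` of `Sp_{2d}(ℚ_p)`: vanishing lower left block. -/
noncomputable def siegelParabolic (p : ℕ) [Fact p.Prime] (d : ℕ) : Subgroup (symplecticGroup (Fin d) ℚ_[p]) where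
  carrier := {g | (g : Matrix (Fin d ⊕ Fin d) (Fin d ⊕ Fin d) ℚ_[p]).toBlocks₂₁ = 0}
  one_mem' := by
    ext i j
    simp [toBlocks₂₁]
  mul_mem' := by
    rintro ⟨g, hg'⟩ ⟨k, hk'⟩ hg hk
    simp only [Set.mem_ofPred_eq] at hg hk ⊢
    change (g * k).toBlocks₂₁ = 0
    rw [← fromBlocks_toBlocks g, ← fromBlocks_toBlocks k, fromBlocks_multiply,
      toBlocks_fromBlocks₂₁, hg, hk]
    simp
  inv_mem' := by
    rintro ⟨g, hg'⟩ hg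
    simp only [Set.mem_ofPred_eq] at hg ⊢
    rw [SymplecticGroup.coe_inv]
    change (-J (Fin d) ℚ_[p] * gᵀ * J (Fin d) ℚ_[p]).toBlocks₂₁ = 0
    rw [← fromBlocks_toBlocks g, hg, J, fromBlocks_transpose, fromBlocks_neg,
      fromBlocks_multiply, fromBlocks_multiply, toBlocks_fromBlocks₂₁]
    simp

/-- The Grassmannian `P \ Sp_{2d}(ℚ_p)` of right cosets `P g` of the Siegel parabolic. -/
abbrev Grassmannian (p : ℕ) [Fact p.Prime] (d : ℕ) : Type :=
  Quotient (QuotientGroup.rightRel (siegelParabolic p d))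

/-- The right coset `P g`. -/
noncomputable def Grassmannian.mk {p : ℕ} [Fact p.Prime] {d : ℕ} (g : symplecticGroup (Fin d) ℚ_[p]) :
    Grassmannian p d :=
  Quotient.mk _ g

/-- The point `∞ = P` of the Grassmannian. -/
noncomputable def Grassmannian.infty (p : ℕ) [Fact p.Prime] (d : ℕ) : Grassmannian p d := Grassmannian.mk 1

/-- A (non-archimedean) norm on the `ℂ_p`-vector space `V`. -/
structure IsNANorm {p : ℕ} [Fact p.Prime] {V : Type*} [AddCommGroup V] [Module ℂ_[p] V]
    (N : V → ℝ) : Prop where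
  nonneg : ∀ v, 0 ≤ N v
  eq_zero_iff : ∀ v, N v = 0 ↔ v = 0
  smul : ∀ (a : ℂ_[p]) (v : V), N (a • v) = ‖a‖ * N v
  add_le_max : ∀ v w, N (v + w) ≤ max (N v) (N w)

/-- A Heisenberg-invariant norm on the Schwartz space (for the Schrödinger representation). -/
structure IsInvariantNorm {p : ℕ} [Fact p.Prime] {d : ℕ} (ψ : SmoothCharacter p)
    (N : Schwartz p d → ℝ) : Prop where
  isNANorm : IsNANorm (p := p) N
  invariant : ∀ (h : Heis p d) (f : Schwartz p d), N (schrodinger d ψ h f) = N f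

/-- `N₁` is dominated by `N₂`: `N₁ ≤ D * N₂` for some constant `D > 0`. -/
def NormDominated {V : Type*} (N₁ N₂ : V → ℝ) : Prop := ∃ D : ℝ, 0 < D ∧ ∀ v, N₁ v ≤ D * N₂ v

/-- `N₁` and `N₂` are homothetic: `N₁ = c * N₂` for some constant `c > 0`. -/
def NormHomothetic {V : Type*} (N₁ N₂ : V → ℝ) : Prop := ∃ c : ℝ, 0 < c ∧ ∀ v, N₁ v = c * N₂ v

/-- The sup norm on the Schwartz space (a Schwartz function takes finitely many values). -/
noncomputable def supNorm {p : ℕ} [Fact p.Prime] {d : ℕ} (f : Schwartz p d) : ℝ :=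
  ⨆ x : Qpd p d, ‖(f : Qpd p d → ℂ_[p]) x‖

/-- `N` is the norm `‖·‖_α` attached to the point `α` of the Grassmannian: `α = P g`, `N` lies in
the homothety class of `f ↦ ‖T_g f‖_sup` for an intertwining operator `T_g`, and `N` is normalized
at `1_{ℤ_p^d}`. -/
structure IsGrassmannianNorm {p : ℕ} [Fact p.Prime] {d : ℕ} (ψ : SmoothCharacter p)
    (α : Grassmannian p d) (N : Schwartz p d → ℝ) : Prop where
  homothetic : ∃ g : symplecticGroup (Fin d) ℚ_[p], Grassmannian.mk g = α ∧
    ∃ T : Schwartz p d ≃ₗ[ℂ_[p]] Schwartz p d, IsIntertwining ψ g T ∧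
      NormHomothetic N (fun f => supNorm (T f))
  normalized : N (charZp p d) = 1

/-!
An intertwining operator transports the norm `N` to an invariant norm dominated by the sup norm, so
only the sup norm has to be treated.

The key fact is that an invariant norm `N` dominated by the sup norm does not increase under
multiplication by the indicator function of a set `‖x i‖ ≤ p ^ (-n)`
(`IsInvariantNorm.map_restrict_le`). Given this, let `f` be a Schwartz function that is constant on
the cosets of `p ^ n ℤ_p^d`. After a translation `‖f‖` is maximal at `0`, and cutting `f` off to
`p ^ n ℤ_p^d` gives `supNorm f * N (charBall p d n) ≤ N f`. The opposite inequality holds because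
`f` is a combination of translates of `charBall p d n`. The resulting equality, applied to
`charZp p d`, shows that `N (charBall p d n)` does not depend on `n`, and then
`N f = N (charZp p d) * supNorm f`.

By invariance under multiplication by characters, multiplication by a sum `∑ cᵢ ψ (bᵢ x)` with
`‖cᵢ‖ ≤ 1` does not increase `N`. As `N` is dominated by the sup norm, the key fact follows if the
indicator function, multiplied by a constant of norm arbitrarily close to `1`, is a uniform limit of
such sums on compact sets. The Fourier expansion does not help, since its coefficients have
powers of `p` in the denominator. Instead, a function on `ℤ_p / p ^ n` is interpolated by a
polynomial in `χ (x / p ^ (n + s))`, with nodes `χ (a / p ^ (n + s))` for `0 ≤ a < p ^ n`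
(`approximates_of_norm_le`). If `‖ρ‖ ^ (p ^ s) = 1 / p`, then the barycentric weights have norm
`‖ρ‖ ^ n`, and the error has size `‖ρ‖` and factors through `ℤ_p / p ^ (n + s)`. So the error can be
interpolated in turn. When the coefficients have to stay bounded by a fixed constant larger than `1`,
the levels from `p ^ t` to `p ^ (t + 1)` reduce the error by a factor `exp (-c / t)`
(`exists_approximates_block`), and the divergence of the harmonic series makes the error arbitrarily
small (`exists_mem_charRing_norm_sub_le`).
-/

/-! ### Distances of `p`-power roots of unity from `1` -/

section RootsOfUnity

/-- For a root of unity `ζ` of order `N`, this product is the derivative of `X ^ N - 1` at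
`ζ ^ i`. -/
theorem IsPrimitiveRoot.norm_prod_pow_sub_pow {K : Type*} [NormedField K] {ζ : K} {N i : ℕ}
    (hζ : IsPrimitiveRoot ζ N) (hi : i < N) : ∏ a ∈ (Finset.range N).erase i, ‖ζ ^ i - ζ ^ a‖ = ‖(N : K)‖ := by
  have hN : N ≠ 0 := by omega
  have : NeZero N := ⟨hN⟩
  have h1 : ‖ζ‖ = 1 := (hζ.isOfFinOrder hN).norm_eq_one
  have hnod : Lagrange.nodal (Finset.range N) (fun a => ζ ^ a) = Polynomial.X ^ N - 1 := by
    rw [Polynomial.X_pow_sub_one_eq_prod (Nat.pos_of_ne_zero hN) hζ, Lagrange.nodal]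
    refine Finset.prod_bij (fun a _ => ζ ^ a) ?_ ?_ ?_ ?_
    · intro a _
      rw [Polynomial.mem_nthRootsFinset (Nat.pos_of_ne_zero hN), ← pow_mul, mul_comm, pow_mul,
        hζ.pow_eq_one, one_pow]
    · intro a ha b hb hab
      exact hζ.pow_inj (Finset.mem_range.1 ha) (Finset.mem_range.1 hb) hab
    · intro b hb
      rw [Polynomial.mem_nthRootsFinset (Nat.pos_of_ne_zero hN)] at hb
      obtain ⟨i, hi, rfl⟩ := hζ.eq_pow_of_pow_eq_one hb
      exact ⟨i, Finset.mem_range.2 hi, rfl⟩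
    · intro a _
      rfl
  have hev := Lagrange.eval_nodal_derivative_eval_node_eq (v := fun a => ζ ^ a)
    (Finset.mem_range.2 hi)
  rw [hnod, Lagrange.eval_nodal] at hev
  rw [← norm_prod, ← hev]
  rw [Polynomial.derivative_sub, Polynomial.derivative_X_pow]
  simp [h1]

variable {K : Type*} [NormedField K] [IsUltrametricDist K]

theorem norm_pow_sub_one_le {ζ : K} (hζ : ‖ζ‖ ≤ 1) (n : ℕ) : ‖ζ ^ n - 1‖ ≤ ‖ζ - 1‖ := by
  rw [← geom_sum_mul, norm_mul]
  refine mul_le_of_le_one_left (norm_nonneg _) ?_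
  refine IsUltrametricDist.norm_sum_le_of_forall_le_of_nonneg zero_le_one fun i _ => ?_
  rw [norm_pow]
  exact pow_le_one₀ (norm_nonneg _) hζ

theorem IsPrimitiveRoot.norm_sub_one_le {ζ τ : K} {n : ℕ} (hn : n ≠ 0) (hζ : IsPrimitiveRoot ζ n)
    (hτ : τ ^ n = 1) : ‖τ - 1‖ ≤ ‖ζ - 1‖ := by
  have : NeZero n := ⟨hn⟩
  obtain ⟨i, -, rfl⟩ := hζ.eq_pow_of_pow_eq_one hτ
  exact norm_pow_sub_one_le (hζ.isOfFinOrder hn).norm_eq_one.le i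

variable {p : ℕ} [hp : Fact p.Prime]

/-- The norm of `ζ - 1` is read off from `∏ (1 - ζ') = Φ_{p ^ (k + 1)}(1) = p`, in which all factors
have the same norm. -/
theorem IsPrimitiveRoot.norm_sub_one_pow_eq (hK : ‖(p : K)‖ = (p : ℝ)⁻¹) {ζ : K} {k : ℕ}
    (hζ : IsPrimitiveRoot ζ (p ^ (k + 1))) : ‖ζ - 1‖ ^ (p ^ k * (p - 1)) = (p : ℝ)⁻¹ := by
  have h0 : p ^ (k + 1) ≠ 0 := pow_ne_zero _ hp.out.ne_zero
  have h1 := Polynomial.eval_one_cyclotomic_prime_pow (R := K) (p := p) k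
  rw [Polynomial.cyclotomic_eq_prod_X_sub_primitiveRoots hζ, Polynomial.eval_prod] at h1
  rw [← hK, ← h1, norm_prod, Finset.prod_congr rfl (g := fun _ => ‖ζ - 1‖), Finset.prod_const,
    hζ.card_primitiveRoots, Nat.totient_prime_pow_succ hp.out]
  intro μ hμ
  have hμ' := isPrimitiveRoot_of_mem_primitiveRoots hμ
  rw [Polynomial.eval_sub, Polynomial.eval_X, Polynomial.eval_C, norm_sub_rev]
  exact le_antisymm (hζ.norm_sub_one_le h0 hμ'.pow_eq_one) (hμ'.norm_sub_one_le h0 hζ.pow_eq_one)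

/-- For a `p`-power root of unity `η`, as long as `η ^ (p ^ s) ≠ 1`, raising `η` to the power
`p ^ s` raises the norm of `η - 1` to the same power. -/
theorem norm_pow_sub_one_eq_of_ne_one (hK : ‖(p : K)‖ = (p : ℝ)⁻¹) {η : K} {N s : ℕ}
    (hη : η ^ p ^ N = 1) (hne : η ^ p ^ s ≠ 1) : ‖η ^ p ^ s - 1‖ = ‖η - 1‖ ^ p ^ s := by
  obtain ⟨j, -, hj⟩ := (Nat.dvd_prime_pow hp.out).1 (orderOf_dvd_of_pow_eq_one hη)
  have hprim : IsPrimitiveRoot η (p ^ j) := hj ▸ IsPrimitiveRoot.orderOf η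
  have hsj : s < j := by
    by_contra! h
    exact hne (orderOf_dvd_iff_pow_eq_one.1 (hj ▸ pow_dvd_pow p h))
  obtain ⟨k, rfl⟩ : ∃ k, j = s + (k + 1) := ⟨j - s - 1, by omega⟩
  have hprim' : IsPrimitiveRoot (η ^ p ^ s) (p ^ (k + 1)) :=
    hprim.pow (pow_pos hp.out.pos _) (pow_add _ _ _)
  have e1 := hprim'.norm_sub_one_pow_eq hK
  have e2 := IsPrimitiveRoot.norm_sub_one_pow_eq (k := s + k) hK hprim
  have h0 : p ^ k * (p - 1) ≠ 0 :=
    mul_ne_zero (pow_ne_zero _ hp.out.ne_zero) (Nat.sub_ne_zero_of_lt hp.out.one_lt)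
  refine (pow_left_inj₀ (norm_nonneg _) (by positivity) h0).1 (e1.trans ?_)
  rw [← e2, ← pow_mul, pow_add, mul_assoc]

theorem inv_prime_le_norm_sub_one_pow (hK : ‖(p : K)‖ = (p : ℝ)⁻¹) {η : K} {N : ℕ}
    (hη : η ^ p ^ N = 1) (hne : η ≠ 1) : (p : ℝ)⁻¹ ≤ ‖η - 1‖ ^ (p - 1) := by
  obtain ⟨j, -, hj⟩ := (Nat.dvd_prime_pow hp.out).1 (orderOf_dvd_of_pow_eq_one hη)
  have hprim : IsPrimitiveRoot η (p ^ j) := hj ▸ IsPrimitiveRoot.orderOf η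
  obtain _ | k := j
  · exact absurd (by simpa using hprim) hne
  · rw [← hprim.norm_sub_one_pow_eq hK, mul_comm, pow_mul]
    refine pow_le_of_le_one (by positivity) (pow_le_one₀ (norm_nonneg _) ?_)
      (pow_ne_zero _ hp.out.ne_zero)
    have h1 : ‖η‖ = 1 := (hprim.isOfFinOrder (pow_ne_zero _ hp.out.ne_zero)).norm_eq_one
    simpa [h1, sub_eq_add_neg] using IsUltrametricDist.norm_add_le_max η (-1)

end RootsOfUnity

/-! ### Lagrange basis polynomials near the nodes -/

section LagrangeInterpolation

variable {K ι : Type*} [NormedField K] [IsUltrametricDist K] [DecidableEq ι]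

theorem norm_prod_sub_one_le (s : Finset ι) (f : ι → K) {r : ℝ} (hr0 : 0 ≤ r) (hr1 : r ≤ 1)
    (hf : ∀ a ∈ s, ‖f a - 1‖ ≤ r) : ‖∏ a ∈ s, f a - 1‖ ≤ r := by
  induction s using Finset.induction_on with
  | empty => simpa using hr0
  | insert a s ha ih =>
    rw [Finset.prod_insert ha]
    have h1 := ih fun b hb => hf b (Finset.mem_insert_of_mem hb)
    have h2 := hf a (Finset.mem_insert_self a s)
    have e : f a * ∏ b ∈ s, f b - 1
        = (f a - 1) * (∏ b ∈ s, f b - 1) + ((f a - 1) + (∏ b ∈ s, f b - 1)) := by ring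
    rw [e]
    refine (IsUltrametricDist.norm_add_le_max _ _).trans (max_le ?_ ?_)
    · rw [norm_mul]
      exact (mul_le_mul h2 h1 (norm_nonneg _) hr0).trans (mul_le_of_le_one_left hr0 hr1)
    · exact (IsUltrametricDist.norm_add_le_max _ _).trans (max_le h2 h1)

variable {s : Finset ι} {v : ι → K} {z : K} {i j : ι} {r : ℝ}

/-- The value of a Lagrange basis polynomial at a point close to its own node. -/
theorem norm_lagrange_sub_one_le (hr0 : 0 ≤ r) (hr1 : r ≤ 1)
    (hinj : ∀ a ∈ s.erase i, v i ≠ v a) (hz : ∀ a ∈ s.erase i, ‖z - v i‖ ≤ r * ‖v i - v a‖) :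
    ‖∏ a ∈ s.erase i, (z - v a) / (v i - v a) - 1‖ ≤ r := by
  refine norm_prod_sub_one_le _ _ hr0 hr1 fun a ha => ?_
  have h0 : v i - v a ≠ 0 := sub_ne_zero.2 (hinj a ha)
  have e : (z - v a) / (v i - v a) - 1 = (z - v i) / (v i - v a) := by
    field_simp
    ring
  rw [e, norm_div, div_le_iff₀ (norm_pos_iff.2 h0)]
  exact hz a ha

/-- The value of a Lagrange basis polynomial at a point close to a node other than its own. -/
theorem norm_lagrange_le (hr1 : r < 1) (hi : i ∈ s) (hj : j ∈ s) (hij : j ≠ i)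
    (hinj : ∀ a ∈ s.erase i, v i ≠ v a) (hz : ∀ a ∈ s.erase i, ‖z - v i‖ ≤ r * ‖v i - v a‖)
    (hw : ∏ a ∈ s.erase i, ‖v i - v a‖ = ∏ a ∈ s.erase j, ‖v j - v a‖) :
    ‖∏ a ∈ s.erase j, (z - v a) / (v j - v a)‖ ≤ r := by
  have hji : j ∈ s.erase i := Finset.mem_erase.2 ⟨hij, hj⟩
  have hij' : i ∈ s.erase j := Finset.mem_erase.2 ⟨hij.symm, hi⟩
  have hpos : ∀ a ∈ s.erase i, 0 < ‖v i - v a‖ := fun a ha =>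
    norm_pos_iff.2 (sub_ne_zero.2 (hinj a ha))
  have hfar : ∀ a ∈ s.erase i, ‖z - v a‖ = ‖v i - v a‖ := by
    intro a ha
    have h1 : ‖z - v i‖ < ‖v i - v a‖ :=
      (hz a ha).trans_lt (mul_lt_of_lt_one_left (hpos a ha) hr1)
    have := IsUltrametricDist.norm_add_eq_max_of_norm_ne_norm h1.ne
    rwa [sub_add_sub_cancel, max_eq_right h1.le] at this
  have hW : 0 < ∏ a ∈ s.erase i, ‖v i - v a‖ := Finset.prod_pos hpos
  rw [Finset.prod_div_distrib, norm_div, norm_prod, norm_prod, ← hw, div_le_iff₀ hW,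
    ← Finset.mul_prod_erase _ _ hij', ← Finset.mul_prod_erase _ _ hji, ← mul_assoc,
    Finset.erase_right_comm]
  refine mul_le_mul (hz j hji) (le_of_eq ?_) (by positivity) (by
    exact (norm_nonneg _).trans (hz j hji))
  refine Finset.prod_congr rfl fun a ha => hfar a ?_
  exact Finset.mem_of_mem_erase ha

end LagrangeInterpolation

/-! ### Interpolation nodes at roots of unity -/

section Nodes

variable {K : Type*} [NormedField K] {p : ℕ} [hp : Fact p.Prime]
  {n s i a : ℕ} {ζ ρ z : K}

theorem IsPrimitiveRoot.pow_ne_pow_of_lt (hζ : IsPrimitiveRoot ζ (p ^ (n + s))) (hi : i < p ^ n)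
    (ha : a < p ^ n) (hia : i ≠ a) : ζ ^ i ≠ ζ ^ a := by
  have h : p ^ n ≤ p ^ (n + s) := Nat.pow_le_pow_right hp.out.pos (Nat.le_add_right n s)
  exact fun h' => hia (hζ.pow_inj (hi.trans_le h) (ha.trans_le h) h')

theorem IsPrimitiveRoot.pow_prime_pow (hζ : IsPrimitiveRoot ζ (p ^ (n + s))) :
    IsPrimitiveRoot (ζ ^ p ^ s) (p ^ n) :=
  hζ.pow (pow_pos hp.out.pos _) (by rw [pow_add, mul_comm])

theorem IsPrimitiveRoot.norm_pow_sub_pow_pow [IsUltrametricDist K]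
    (hK : ‖(p : K)‖ = (p : ℝ)⁻¹)
    (hζ : IsPrimitiveRoot ζ (p ^ (n + s))) (hi : i < p ^ n) (ha : a < p ^ n) (hia : i ≠ a) :
    ‖ζ ^ i - ζ ^ a‖ ^ p ^ s = ‖(ζ ^ p ^ s) ^ i - (ζ ^ p ^ s) ^ a‖ ∧
      (p : ℝ)⁻¹ ≤ (‖ζ ^ i - ζ ^ a‖ ^ p ^ s) ^ (p - 1) := by
  have h0 : p ^ (n + s) ≠ 0 := pow_ne_zero _ hp.out.ne_zero
  have hζ0 : ζ ≠ 0 := hζ.ne_zero h0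
  have hζ1 : ‖ζ‖ = 1 := (hζ.isOfFinOrder h0).norm_eq_one
  set η := ζ ^ i / ζ ^ a with hη
  have hη1 : η ^ p ^ (n + s) = 1 := by
    rw [hη, div_pow, ← pow_mul, ← pow_mul, mul_comm i, mul_comm a, pow_mul, pow_mul,
      hζ.pow_eq_one, one_pow, one_pow, div_one]
  have hsub : ∀ x y : K, ‖y‖ = 1 → ‖x - y‖ = ‖x / y - 1‖ := by
    intro x y hy
    have hy0 : y ≠ 0 := by
      rintro rfl
      simp at hy
    rw [div_sub_one hy0, norm_div, hy, div_one]
  have e : (ζ ^ p ^ s) ^ i / (ζ ^ p ^ s) ^ a = η ^ p ^ s := by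
    rw [hη, div_pow, ← pow_mul, ← pow_mul, ← pow_mul, ← pow_mul, mul_comm i, mul_comm a]
  have hne : η ^ p ^ s ≠ 1 := by
    rw [← e, Ne, div_eq_one_iff_eq (pow_ne_zero _ (pow_ne_zero _ hζ0))]
    exact fun h => hia (hζ.pow_prime_pow.pow_inj hi ha h)
  have key := norm_pow_sub_one_eq_of_ne_one hK hη1 hne
  rw [hsub (ζ ^ i) (ζ ^ a) (by simp [hζ1]), hsub _ ((ζ ^ p ^ s) ^ a) (by simp [hζ1]), e, ← hη, key]
  refine ⟨rfl, ?_⟩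
  rw [← key]
  refine inv_prime_le_norm_sub_one_pow (N := n) hK ?_ hne
  rw [← pow_mul, ← pow_add, add_comm s n, hη1]

/-- All barycentric weights at the nodes `ζ ^ a`, `a < p ^ n`, have the same norm. It is much
closer to `1` than `‖p‖ ^ n`, its value for `s = 0`. -/
theorem IsPrimitiveRoot.prod_norm_pow_sub_pow [IsUltrametricDist K]
    (hK : ‖(p : K)‖ = (p : ℝ)⁻¹)
    (hζ : IsPrimitiveRoot ζ (p ^ (n + s))) (hρ : ‖ρ‖ ^ p ^ s = (p : ℝ)⁻¹) (hi : i < p ^ n) :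
    ∏ a ∈ (Finset.range (p ^ n)).erase i, ‖ζ ^ i - ζ ^ a‖ = ‖ρ‖ ^ n := by
  refine (pow_left_inj₀ (by positivity) (by positivity) (pow_ne_zero s hp.out.ne_zero)).1 ?_
  rw [← pow_mul, mul_comm n, pow_mul, hρ, ← Finset.prod_pow, ← hK, ← norm_pow, ← Nat.cast_pow,
    ← hζ.pow_prime_pow.norm_prod_pow_sub_pow hi]
  refine Finset.prod_congr rfl fun a ha => ?_
  have ha' := Finset.mem_erase.1 ha
  exact (hζ.norm_pow_sub_pow_pow hK hi (Finset.mem_range.1 ha'.2) ha'.1.symm).1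

/-- A root of unity congruent to the node `ζ ^ i` modulo roots of unity of order `p ^ s` is closer
to that node than the other nodes are, by a factor `‖ρ‖`. -/
theorem IsPrimitiveRoot.norm_sub_pow_le [IsUltrametricDist K]
    (hK : ‖(p : K)‖ = (p : ℝ)⁻¹)
    (hζ : IsPrimitiveRoot ζ (p ^ (n + s))) (hs : s ≠ 0) (hρ : ‖ρ‖ ^ p ^ s = (p : ℝ)⁻¹)
    (hi : i < p ^ n) (ha : a < p ^ n) (hia : i ≠ a) (hz : z ^ p ^ s = (ζ ^ i) ^ p ^ s) :
    ‖z - ζ ^ i‖ ≤ ‖ρ‖ * ‖ζ ^ i - ζ ^ a‖ := by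
  have h0 : p ^ (n + s) ≠ 0 := pow_ne_zero _ hp.out.ne_zero
  have hζ0 : ζ ^ i ≠ 0 := pow_ne_zero _ (hζ.ne_zero h0)
  have hζ1 : ‖ζ‖ = 1 := (hζ.isOfFinOrder h0).norm_eq_one
  obtain ⟨t, rfl⟩ := Nat.exists_eq_succ_of_ne_zero hs
  have hξ : IsPrimitiveRoot (ζ ^ p ^ n) (p ^ (t + 1)) :=
    hζ.pow (pow_pos hp.out.pos _) (pow_add _ _ _)
  have h1 : ‖z - ζ ^ i‖ ≤ ‖ζ ^ p ^ n - 1‖ := by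
    have : ‖z - ζ ^ i‖ = ‖z / ζ ^ i - 1‖ := by
      rw [div_sub_one hζ0, norm_div, norm_pow, hζ1, one_pow, div_one]
    rw [this]
    refine hξ.norm_sub_one_le (pow_ne_zero _ hp.out.ne_zero) ?_
    rw [div_pow, hz, div_self (pow_ne_zero _ hζ0)]
  have hp1 : p - 1 ≠ 0 := Nat.sub_ne_zero_of_lt hp.out.one_lt
  have h2 : ((‖ζ ^ p ^ n - 1‖) ^ p ^ (t + 1)) ^ (p - 1) = (p : ℝ)⁻¹ ^ p := by
    rw [← hξ.norm_sub_one_pow_eq hK, ← pow_mul, ← pow_mul, pow_succ]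
    congr 1
    ring
  have h3 := (hζ.norm_pow_sub_pow_pow hK hi ha hia).2
  refine h1.trans ?_
  refine (pow_le_pow_iff_left₀ (norm_nonneg _) (by positivity)
    (mul_ne_zero (pow_ne_zero (t + 1) hp.out.ne_zero) hp1)).1 ?_
  rw [pow_mul, pow_mul, h2, mul_pow, mul_pow, hρ]
  calc (p : ℝ)⁻¹ ^ p = (p : ℝ)⁻¹ ^ (p - 1) * (p : ℝ)⁻¹ := by
        rw [← pow_succ, Nat.sub_add_cancel hp.out.pos]
    _ ≤ _ := by gcongr

end Nodes

/-! ### Integral combinations of characters on `ℤ_p` -/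

section CharacterCombinations

variable {K : Type*} [NormedField K] {p : ℕ} [hp : Fact p.Prime]

/-- The ring of finite sums `x ↦ ∑ cᵢ χ (bᵢ x)` with integral coefficients, `‖cᵢ‖ ≤ 1`. -/
def charRing (χ : AddChar ℚ_[p] K) : Subring (ℚ_[p] → K) :=
  Subring.closure {f | ∃ (c : K) (b : ℚ_[p]), ‖c‖ ≤ 1 ∧ f = fun x => c * χ (b * x)}

/-- A function whose restriction to `ℤ_p` factors through `ℤ_p / p ^ n` and is bounded by `1`. -/
def IsIntegralOfLevel (n : ℕ) (φ : ℚ_[p] → K) : Prop :=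
  (∀ x y, ‖x‖ ≤ 1 → ‖y‖ ≤ 1 → ‖x - y‖ ≤ (p : ℝ)⁻¹ ^ n → φ x = φ y) ∧ ∀ x, ‖x‖ ≤ 1 → ‖φ x‖ ≤ 1

/-- `φ` becomes an integral combination of characters on `ℤ_p` after multiplication by `γ`, up to
an error of size `‖γ‖ * ‖r‖` that factors through `ℤ_p / p ^ m`; and this for every integral `φ`
of level `n`. -/
def Approximates (χ : AddChar ℚ_[p] K) (γ : K) (n m : ℕ) (r : K) : Prop :=
  ∀ φ : ℚ_[p] → K, IsIntegralOfLevel n φ → ∃ b ∈ charRing χ, ∃ e, IsIntegralOfLevel m e ∧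
    ∀ x, ‖x‖ ≤ 1 → γ * φ x = b x + γ * (r * e x)

variable {χ : AddChar ℚ_[p] K} {γ r r' ρ : K} {n m k s : ℕ}

theorem mul_char_mem_charRing {c : K} (hc : ‖c‖ ≤ 1) (b : ℚ_[p]) :
    (fun x => c * χ (b * x)) ∈ charRing χ :=
  Subring.subset_closure ⟨c, b, hc, rfl⟩

theorem const_mem_charRing {c : K} (hc : ‖c‖ ≤ 1) : (fun _ => c) ∈ charRing χ := by
  simpa using mul_char_mem_charRing (χ := χ) hc 0

theorem comp_mul_mem_charRing {b : ℚ_[p] → K} (hb : b ∈ charRing χ) (t : ℚ_[p]) :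
    (fun x => b (t * x)) ∈ charRing χ := by
  induction hb using Subring.closure_induction with
  | mem f hf =>
    obtain ⟨c, u, hc, rfl⟩ := hf
    simpa [mul_assoc] using mul_char_mem_charRing (χ := χ) hc (u * t)
  | zero => exact zero_mem _
  | one => exact one_mem _
  | add f g _ _ hf hg => exact add_mem hf hg
  | neg f _ hf => exact neg_mem hf
  | mul f g _ _ hf hg => exact mul_mem hf hg

theorem IsIntegralOfLevel.mono (hnm : n ≤ m) {φ : ℚ_[p] → K} (hφ : IsIntegralOfLevel n φ) :
    IsIntegralOfLevel m φ := by
  refine ⟨fun x y hx hy hxy => hφ.1 x y hx hy (hxy.trans ?_), hφ.2⟩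
  exact pow_le_pow_of_le_one (by positivity) (inv_le_one_of_one_le₀ (by
    exact_mod_cast hp.out.one_le)) hnm

theorem Approximates.mono_right {m' : ℕ} (hm : m ≤ m') (h : Approximates χ γ n m r) :
    Approximates χ γ n m' r := by
  intro φ hφ
  obtain ⟨b, hb, e, he, h'⟩ := h φ hφ
  exact ⟨b, hb, e, he.mono hm, h'⟩

theorem Approximates.refl (n : ℕ) : Approximates χ γ n n 1 := fun φ hφ =>
  ⟨0, zero_mem _, φ, hφ, fun x _ => by simp⟩

theorem Approximates.trans (hr : ‖r‖ ≤ 1) (h : Approximates χ γ n m r)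
    (h' : Approximates χ γ m k r') : Approximates χ γ n k (r * r') := by
  intro φ hφ
  obtain ⟨b, hb, e, he, h1⟩ := h φ hφ
  obtain ⟨b', hb', e', he', h2⟩ := h' e he
  refine ⟨b + (fun _ => r) * b', add_mem hb (mul_mem (const_mem_charRing hr) hb'), e', he',
    fun x hx => ?_⟩
  have := h2 x hx
  rw [h1 x hx, Pi.add_apply, Pi.mul_apply]
  linear_combination r * this

theorem isPrimitiveRoot_char (hχ : ∀ x, ‖x‖ ≤ 1 → χ x = 1) (hχp : χ (p : ℚ_[p])⁻¹ ≠ 1) (m : ℕ) :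
    IsPrimitiveRoot (χ ((p : ℚ_[p]) ^ m)⁻¹) (p ^ m) := by
  have hp0 : (p : ℚ_[p]) ≠ 0 := Nat.cast_ne_zero.2 hp.out.ne_zero
  obtain _ | m := m
  · simpa using hχ 1 (by simp)
  · have h1 : ¬ χ ((p : ℚ_[p]) ^ (m + 1))⁻¹ ^ p ^ m = 1 := by
      rw [← AddChar.map_nsmul_eq_pow, nsmul_eq_mul, Nat.cast_pow]
      convert hχp using 2
      rw [pow_succ, mul_inv, ← mul_assoc, mul_inv_cancel₀ (pow_ne_zero _ hp0), one_mul]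
    have h2 : χ ((p : ℚ_[p]) ^ (m + 1))⁻¹ ^ p ^ (m + 1) = 1 := by
      rw [← AddChar.map_nsmul_eq_pow, nsmul_eq_mul, Nat.cast_pow, mul_inv_cancel₀ (pow_ne_zero _ hp0)]
      exact hχ 1 (by simp)
    exact orderOf_eq_prime_pow h1 h2 ▸ IsPrimitiveRoot.orderOf _

theorem exists_nat_norm_sub_le (n : ℕ) {x : ℚ_[p]} (hx : ‖x‖ ≤ 1) :
    ∃ a < p ^ n, ‖x - (a : ℚ_[p])‖ ≤ (p : ℝ)⁻¹ ^ n := by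
  obtain ⟨y, rfl⟩ : ∃ y : ℤ_[p], (y : ℚ_[p]) = x := ⟨⟨x, hx⟩, rfl⟩
  refine ⟨y.appr n, y.appr_lt n, ?_⟩
  have := (PadicInt.norm_le_pow_iff_mem_span_pow _ _).2 (y.appr_spec n)
  rw [PadicInt.norm_def, PadicInt.coe_sub, PadicInt.coe_natCast] at this
  simpa using this

/-- Lagrange interpolation at the nodes `ζ ^ a = χ (a / p ^ (n + s))`, `a < p ^ n`. -/
theorem approximates_of_norm_le [IsUltrametricDist K]
    (hK : ‖(p : K)‖ = (p : ℝ)⁻¹) (hχ : ∀ x, ‖x‖ ≤ 1 → χ x = 1)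
    (hχp : χ (p : ℚ_[p])⁻¹ ≠ 1) (hs : s ≠ 0) (hρ : ‖ρ‖ ^ p ^ s = (p : ℝ)⁻¹)
    (hγ : ‖γ‖ ≤ ‖ρ‖ ^ n) : Approximates χ γ n (n + s) ρ := by
  intro φ hφ
  have hp0 : (p : ℚ_[p]) ≠ 0 := Nat.cast_ne_zero.2 hp.out.ne_zero
  have hζ := isPrimitiveRoot_char hχ hχp (n + s)
  set u : ℚ_[p] → K := fun x => χ (((p : ℚ_[p]) ^ (n + s))⁻¹ * x) with hu
  set ζ := χ ((p : ℚ_[p]) ^ (n + s))⁻¹ with hζdef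
  have hpos : 0 < ‖ρ‖ := by
    refine (norm_nonneg ρ).lt_of_ne fun h => ?_
    rw [← h, zero_pow (pow_ne_zero _ hp.out.ne_zero)] at hρ
    exact hp.out.ne_zero (by simpa using hρ.symm)
  have hlt : ‖ρ‖ < 1 := by
    by_contra! h
    have := one_le_pow₀ h (n := p ^ s)
    rw [hρ] at this
    exact absurd this (not_le.2 (inv_lt_one_of_one_lt₀ (by exact_mod_cast hp.out.one_lt)))
  set S := Finset.range (p ^ n) with hS
  have hne : ∀ i ∈ S, ∀ a ∈ S.erase i, ζ ^ i ≠ ζ ^ a := fun i hi a ha =>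
    hζ.pow_ne_pow_of_lt (Finset.mem_range.1 hi)
      (Finset.mem_range.1 (Finset.mem_of_mem_erase ha)) (Finset.ne_of_mem_erase ha).symm
  have hw : ∀ i ∈ S, ∏ a ∈ S.erase i, ‖ζ ^ i - ζ ^ a‖ = ‖ρ‖ ^ n := fun i hi =>
    hζ.prod_norm_pow_sub_pow hK hρ (Finset.mem_range.1 hi)
  set ℓ : ℕ → ℚ_[p] → K := fun i x => ∏ a ∈ S.erase i, (u x - ζ ^ a) / (ζ ^ i - ζ ^ a) with hℓ
  set β : ℚ_[p] → K := fun x => ∑ i ∈ S, φ i * ℓ i x with hβ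
  have hnat : ∀ i : ℕ, ‖(i : ℚ_[p])‖ ≤ 1 := fun i => by
    exact_mod_cast Padic.norm_int_le_one (p := p) i
  -- multiplication by `γ` clears the denominators of the barycentric weights
  have hmem : (fun x => γ * β x) ∈ charRing χ := by
    have e : (fun x => γ * β x) = ∑ i ∈ S, (fun _ => φ i) *
        ((fun _ => γ / ∏ a ∈ S.erase i, (ζ ^ i - ζ ^ a)) *
          ∏ a ∈ S.erase i, (u - fun _ => ζ ^ a)) := by
      ext x
      simp only [hβ, hℓ, Finset.mul_sum, Finset.sum_apply, Pi.mul_apply, Finset.prod_apply,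
        Pi.sub_apply, Finset.prod_div_distrib]
      exact Finset.sum_congr rfl fun i _ => by ring
    rw [e]
    refine sum_mem fun i hi => mul_mem (const_mem_charRing (hφ.2 _ (hnat i))) (mul_mem
      (const_mem_charRing ?_) (prod_mem fun a _ => sub_mem ?_ (const_mem_charRing ?_)))
    · rw [norm_div, norm_prod, hw i hi]
      exact div_le_one_of_le₀ hγ (by positivity)
    · simpa [hu] using mul_char_mem_charRing (χ := χ) (c := 1) (by simp) ((p : ℚ_[p]) ^ (n + s))⁻¹
    · rw [norm_pow, (hζ.isOfFinOrder (pow_ne_zero _ hp.out.ne_zero)).norm_eq_one, one_pow]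
  have hclose : ∀ x, ‖x‖ ≤ 1 → ‖φ x - β x‖ ≤ ‖ρ‖ := by
    intro x hx
    obtain ⟨i, hi, hxi⟩ := exists_nat_norm_sub_le n hx
    have hiS : i ∈ S := Finset.mem_range.2 hi
    have hz : u x ^ p ^ s = (ζ ^ i) ^ p ^ s := by
      have h1 : χ (((p : ℚ_[p]) ^ n)⁻¹ * (x - i)) = 1 := by
        refine hχ _ ?_
        rw [norm_mul, norm_inv, norm_pow, Padic.norm_p, inv_pow, inv_inv]
        calc (p : ℝ) ^ n * ‖x - i‖ ≤ (p : ℝ) ^ n * (p : ℝ)⁻¹ ^ n := by gcongr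
          _ = 1 := by
            rw [← mul_pow, mul_inv_cancel₀ (by exact_mod_cast hp.out.ne_zero), one_pow]
      have e : p ^ s • (((p : ℚ_[p]) ^ (n + s))⁻¹ * x)
          = ((p : ℚ_[p]) ^ n)⁻¹ * (x - i) + p ^ s • i • ((p : ℚ_[p]) ^ (n + s))⁻¹ := by
        simp only [nsmul_eq_mul, Nat.cast_pow, pow_add]
        field_simp
        ring
      rw [hu, hζdef, ← AddChar.map_nsmul_eq_pow, ← AddChar.map_nsmul_eq_pow,
        ← AddChar.map_nsmul_eq_pow, e, AddChar.map_add_eq_mul, h1, one_mul]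
    have hd : ∀ a ∈ S.erase i, ‖u x - ζ ^ i‖ ≤ ‖ρ‖ * ‖ζ ^ i - ζ ^ a‖ := fun a ha =>
      hζ.norm_sub_pow_le hK hs hρ hi (Finset.mem_range.1 (Finset.mem_of_mem_erase ha))
        (Finset.ne_of_mem_erase ha).symm hz
    have hφx : φ x = φ i := hφ.1 _ _ hx (hnat i) hxi
    rw [norm_sub_rev, hφx]
    have e : β x - φ i = φ i * (ℓ i x - 1) + ∑ j ∈ S.erase i, φ j * ℓ j x := by
      simp only [hβ]
      rw [← Finset.add_sum_erase _ _ hiS]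
      ring
    rw [e]
    refine (IsUltrametricDist.norm_add_le_max _ _).trans (max_le ?_ ?_)
    · rw [norm_mul]
      exact (mul_le_of_le_one_left (norm_nonneg _) (hφ.2 _ (hnat i))).trans
        (norm_lagrange_sub_one_le (v := fun a => ζ ^ a) hpos.le hlt.le (hne i hiS) hd)
    · refine IsUltrametricDist.norm_sum_le_of_forall_le_of_nonneg hpos.le fun j hj => ?_
      have hjS := Finset.mem_of_mem_erase hj
      rw [norm_mul]
      refine (mul_le_of_le_one_left (norm_nonneg _) (hφ.2 _ (hnat j))).trans ?_
      exact norm_lagrange_le (v := fun a => ζ ^ a) hlt hiS hjS (Finset.ne_of_mem_erase hj)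
        (hne i hiS) hd ((hw i hiS).trans (hw j hjS).symm)
  refine ⟨_, hmem, fun x => (φ x - β x) / ρ, ⟨?_, ?_⟩, ?_⟩
  · intro x y hx hy hxy
    have h1 : u x = u y := by
      have : χ (((p : ℚ_[p]) ^ (n + s))⁻¹ * (x - y)) = 1 := by
        refine hχ _ ?_
        rw [norm_mul, norm_inv, norm_pow, Padic.norm_p, inv_pow, inv_inv]
        calc (p : ℝ) ^ (n + s) * ‖x - y‖ ≤ (p : ℝ) ^ (n + s) * (p : ℝ)⁻¹ ^ (n + s) := by gcongr
          _ = 1 := by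
            rw [← mul_pow, mul_inv_cancel₀ (by exact_mod_cast hp.out.ne_zero), one_pow]
      have e : ((p : ℚ_[p]) ^ (n + s))⁻¹ * x
          = ((p : ℚ_[p]) ^ (n + s))⁻¹ * (x - y) + ((p : ℚ_[p]) ^ (n + s))⁻¹ * y := by ring
      simp only [hu]
      rw [e, AddChar.map_add_eq_mul, this, one_mul]
    have h2 : φ x = φ y := hφ.1 x y hx hy (hxy.trans (pow_le_pow_of_le_one (by positivity)
      (inv_le_one_of_one_le₀ (by exact_mod_cast hp.out.one_le)) (Nat.le_add_right n s)))
    simp only [hβ, hℓ, h1, h2]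
  · intro x hx
    rw [norm_div]
    exact div_le_one_of_le₀ (hclose x hx) hpos.le
  · intro x _
    have : ρ ≠ 0 := norm_pos_iff.1 hpos
    field_simp
    ring

end CharacterCombinations

/-! ### Arbitrarily good approximation by integral combinations -/

section Divergence

variable {K : Type*} [NormedField K] [IsUltrametricDist K] {p : ℕ} [hp : Fact p.Prime]
  {χ : AddChar ℚ_[p] K} {ρ : ℕ → K}

theorem pow_eq_of_pow_prime_pow {x y : ℝ} (hx : 0 ≤ x) (hy : 0 ≤ y) {k s : ℕ} (hks : k ≤ s)
    (h : x ^ p ^ s = y ^ p ^ k) : x ^ p ^ (s - k) = y := by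
  refine (pow_left_inj₀ (by positivity) hy (pow_ne_zero k hp.out.ne_zero)).1 ?_
  rw [← pow_mul, ← pow_add, Nat.sub_add_cancel hks, h]

theorem approximates_pow (hK : ‖(p : K)‖ = (p : ℝ)⁻¹) (hχ : ∀ x, ‖x‖ ≤ 1 → χ x = 1)
    (hχp : χ (p : ℚ_[p])⁻¹ ≠ 1) (hρ : ∀ s, ‖ρ s‖ ^ p ^ s = (p : ℝ)⁻¹) {k s : ℕ} (hs : s ≠ 0)
    (hks : k ≤ s) {n j : ℕ} (hn : n + j * s ≤ p ^ (s - k)) :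
    Approximates χ (ρ k) n (n + j * s) (ρ s ^ j) := by
  have hle : ‖ρ s‖ ≤ 1 := by
    by_contra! h
    have := one_lt_pow₀ h (pow_ne_zero s hp.out.ne_zero)
    rw [hρ] at this
    exact absurd this (not_lt.2 (inv_le_one_of_one_le₀ (by exact_mod_cast hp.out.one_le)))
  induction j with
  | zero => simpa using Approximates.refl n
  | succ j ih =>
    have h1 : n + j * s ≤ p ^ (s - k) := by nlinarith
    have h2 : ‖ρ k‖ ≤ ‖ρ s‖ ^ (n + j * s) := by
      rw [← pow_eq_of_pow_prime_pow (p := p) (norm_nonneg (ρ s)) (norm_nonneg (ρ k)) hks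
        ((hρ s).trans (hρ k).symm)]
      exact pow_le_pow_of_le_one (norm_nonneg _) hle h1
    have := (ih h1).trans (by simpa using pow_le_one₀ (norm_nonneg _) hle)
      (approximates_of_norm_le hK hχ hχp hs (hρ s) h2)
    rwa [← pow_succ, add_assoc, ← add_one_mul] at this

/-- With step size `s = k + t + 1`, about `p ^ t / s` steps lead from level `p ^ t` to level
`p ^ (t + 1)`, and each one gains a factor `‖p‖ ^ (1 / p ^ s)`: the exponent gained is of order
`1 / t`. -/
theorem exists_approximates_block (hK : ‖(p : K)‖ = (p : ℝ)⁻¹) (hχ : ∀ x, ‖x‖ ≤ 1 → χ x = 1)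
    (hχp : χ (p : ℚ_[p])⁻¹ ≠ 1) (hρ : ∀ s, ‖ρ s‖ ^ p ^ s = (p : ℝ)⁻¹) {k t : ℕ} (hkt : k + 1 ≤ t) :
    ∃ r, ‖r‖ ≤ Real.exp (-(Real.log p / (4 * p ^ (k + 1)) * (1 / t))) ∧
      Approximates χ (ρ k) (p ^ t) (p ^ (t + 1)) r := by
  set s := k + t + 1 with hs
  set j := p ^ t / s with hj
  have hp2 := hp.out.two_le
  have hst : s ≤ p ^ t := by
    have h1 : t - 1 < 2 ^ (t - 1) := Nat.lt_two_pow_self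
    have h2 : 2 ^ t = 2 * 2 ^ (t - 1) := by
      rw [← pow_succ', Nat.sub_add_cancel (by omega)]
    have h3 : 2 ^ t ≤ p ^ t := Nat.pow_le_pow_left hp2 t
    omega
  have hjs : p ^ t ≤ 2 * (j * s) := by
    have h1 := Nat.div_add_mod (p ^ t) s
    have h2 := Nat.mod_lt (p ^ t) (show 0 < s by omega)
    have h3 : 1 ≤ j := (Nat.one_le_div_iff (by omega)).2 hst
    rw [← hj] at h1
    nlinarith
  have hlev : p ^ t + j * s ≤ p ^ (t + 1) := by
    have h1 : j * s ≤ p ^ t := Nat.div_mul_le_self _ _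
    have h2 : 2 * p ^ t ≤ p ^ (t + 1) := by
      rw [pow_succ, mul_comm]
      exact Nat.mul_le_mul_left _ hp2
    omega
  refine ⟨ρ s ^ j, ?_, (approximates_pow hK hχ hχp hρ (by omega) (by omega) (k := k) (s := s)
    (n := p ^ t) (j := j) (by rwa [show s - k = t + 1 by omega])).mono_right hlev⟩
  have hp0 : (0 : ℝ) < p := by exact_mod_cast hp.out.pos
  have hlog : 0 < Real.log p := Real.log_pos (by exact_mod_cast hp.out.one_lt)
  have hnorm : ‖ρ s‖ = Real.exp (-(Real.log p / p ^ s)) := by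
    refine (pow_left_inj₀ (norm_nonneg _) (Real.exp_pos _).le
      (pow_ne_zero s hp.out.ne_zero)).1 ?_
    rw [hρ, ← Real.exp_nat_mul, Nat.cast_pow, mul_neg, mul_div_cancel₀ _ (by positivity),
      Real.exp_neg, Real.exp_log hp0]
  rw [norm_pow, hnorm, ← Real.exp_nat_mul, Real.exp_le_exp, mul_neg, neg_le_neg_iff]
  have ht0 : (0 : ℝ) < t := by exact_mod_cast (show 0 < t by omega)
  have h1 : (p : ℝ) ^ t ≤ 4 * (j * t) := by
    have h2 : 2 * (j * s) ≤ 4 * (j * t) := by nlinarith [show s ≤ 2 * t by omega]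
    exact_mod_cast hjs.trans h2
  have e : (p : ℝ) ^ s = p ^ (k + 1) * p ^ t := by
    rw [← pow_add]
    congr 1
    omega
  rw [e, div_mul_div_comm, mul_one, mul_div_assoc', div_le_div_iff₀ (by positivity) (by positivity)]
  calc Real.log p * (p ^ (k + 1) * p ^ t) ≤ Real.log p * (p ^ (k + 1) * (4 * (j * t))) := by gcongr
    _ = _ := by ring

/-- Every bounded locally constant function on `ℤ_p` is, up to a scalar `ρ k` of norm close to `1`,
a uniform limit of combinations of characters with integral coefficients. The divergence of the
harmonic series allows arbitrarily small errors. -/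
theorem exists_mem_charRing_norm_sub_le (hK : ‖(p : K)‖ = (p : ℝ)⁻¹)
    (hχ : ∀ x, ‖x‖ ≤ 1 → χ x = 1) (hχp : χ (p : ℚ_[p])⁻¹ ≠ 1)
    (hρ : ∀ s, ‖ρ s‖ ^ p ^ s = (p : ℝ)⁻¹) (k : ℕ) {n : ℕ} {φ : ℚ_[p] → K}
    (hφ : IsIntegralOfLevel n φ) {ε : ℝ} (hε : 0 < ε) :
    ∃ b ∈ charRing χ, ∀ x, ‖x‖ ≤ 1 → ‖ρ k * φ x - b x‖ ≤ ε := by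
  set t₀ := k + n + 1 with ht₀
  set c := Real.log p / (4 * p ^ (k + 1)) * (1 / t₀) with hc
  have hlog : 0 < Real.log p := Real.log_pos (by exact_mod_cast hp.out.one_lt)
  have hp0 : (0 : ℝ) < p := by exact_mod_cast hp.out.pos
  have ht0 : (0 : ℝ) < t₀ := by exact_mod_cast (show 0 < t₀ by omega)
  have hc0 : 0 < c := by positivity
  have key : ∀ I : ℕ, ∃ r, ‖r‖ ≤ Real.exp (-(c * ∑ i ∈ Finset.range I, 1 / ((i : ℝ) + 1))) ∧
      Approximates χ (ρ k) (p ^ t₀) (p ^ (t₀ + I)) r := by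
    intro I
    induction I with
    | zero => exact ⟨1, by simp, Approximates.refl _⟩
    | succ I ih =>
      obtain ⟨r, hr, h⟩ := ih
      obtain ⟨r', hr', h'⟩ := exists_approximates_block hK hχ hχp hρ (k := k) (t := t₀ + I)
        (by omega)
      refine ⟨r * r', ?_, h.trans (hr.trans ?_) h'⟩
      · rw [norm_mul, Finset.sum_range_succ, mul_add, neg_add, Real.exp_add]
        refine mul_le_mul hr (hr'.trans (Real.exp_le_exp.2 (neg_le_neg ?_))) (norm_nonneg _)
          (Real.exp_pos _).le
        rw [hc, mul_assoc]
        refine mul_le_mul_of_nonneg_left ?_ (by positivity)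
        rw [div_mul_div_comm, mul_one]
        refine one_div_le_one_div_of_le (by positivity) ?_
        push_cast
        have : (1 : ℝ) ≤ t₀ := by exact_mod_cast (show 1 ≤ t₀ by omega)
        have hI : (0 : ℝ) ≤ I := Nat.cast_nonneg I
        nlinarith
      · rw [Real.exp_le_one_iff, neg_nonpos]
        exact mul_nonneg hc0.le (Finset.sum_nonneg fun i _ => by positivity)
  have hlim : Filter.Tendsto (fun I : ℕ =>
      Real.exp (-(c * ∑ i ∈ Finset.range I, 1 / ((i : ℝ) + 1)))) Filter.atTop (nhds 0) :=
    Real.tendsto_exp_neg_atTop_nhds_zero.comp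
      (Real.tendsto_sum_range_one_div_nat_succ_atTop.const_mul_atTop hc0)
  obtain ⟨I, hI⟩ := (hlim.eventually_le_const hε).exists
  obtain ⟨r, hr, h⟩ := key I
  have hnt : n ≤ p ^ t₀ := by
    have h1 : t₀ < 2 ^ t₀ := Nat.lt_two_pow_self
    have h2 : 2 ^ t₀ ≤ p ^ t₀ := Nat.pow_le_pow_left hp.out.two_le t₀
    omega
  have hρk : ‖ρ k‖ ≤ 1 := by
    by_contra! h
    have := one_lt_pow₀ h (pow_ne_zero k hp.out.ne_zero)
    rw [hρ] at this
    exact absurd this (not_lt.2 (inv_le_one_of_one_le₀ (by exact_mod_cast hp.out.one_le)))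
  obtain ⟨b, hb, e, he, hbe⟩ := h φ (hφ.mono hnt)
  refine ⟨b, hb, fun x hx => ?_⟩
  rw [hbe x hx, add_sub_cancel_left, norm_mul, norm_mul]
  calc ‖ρ k‖ * (‖r‖ * ‖e x‖) ≤ 1 * (ε * 1) :=
        mul_le_mul hρk (mul_le_mul (hr.trans hI) (he.2 x hx) (norm_nonneg _) hε.le)
          (by positivity) zero_le_one
    _ = ε := by ring

end Divergence

/-! ### Approximation over `ℂ_p` -/

section PadicComplex

theorem indicator_closedBall_one_eq {E F M : Type*} [SeminormedAddCommGroup E]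
    [SeminormedAddCommGroup F] [Zero M] [One M] {x : E} {y : F} {r s : ℝ}
    (h : ‖x‖ ≤ r ↔ ‖y‖ ≤ s) : (Metric.closedBall (0 : E) r).indicator (1 : E → M) x
      = (Metric.closedBall (0 : F) s).indicator (1 : F → M) y := by
  classical
  simp only [Set.indicator_apply, mem_closedBall_zero_iff, Pi.one_apply, h]

theorem IsUltrametricDist.norm_le_iff_of_norm_sub_le {E : Type*} [SeminormedAddCommGroup E]
    [IsUltrametricDist E] {x y : E} {r : ℝ} (h : ‖x - y‖ ≤ r) : ‖x‖ ≤ r ↔ ‖y‖ ≤ r := by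
  constructor
  · intro hx
    have := IsUltrametricDist.norm_add_le_max x (y - x)
    rw [add_sub_cancel] at this
    exact this.trans (max_le hx (by rwa [norm_sub_rev]))
  · intro hy
    have := IsUltrametricDist.norm_add_le_max (x - y) y
    rw [sub_add_cancel] at this
    exact this.trans (max_le h hy)

variable {p : ℕ} [hp : Fact p.Prime]

theorem PadicComplex.norm_natCast_prime : ‖(p : ℂ_[p])‖ = (p : ℝ)⁻¹ := by
  have := PadicComplex.norm_extends' p (p : ℚ_[p])
  rw [Padic.norm_p] at this
  simpa using this

theorem PadicComplex.exists_norm_pow_eq :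
    ∃ ρ : ℕ → ℂ_[p], ∀ s, ‖ρ s‖ ^ p ^ s = (p : ℝ)⁻¹ := by
  have h : ∀ s : ℕ, ∃ z : ℂ_[p], z ^ p ^ s = (p : ℂ_[p]) := fun s =>
    IsAlgClosed.exists_pow_nat_eq _ (pow_pos hp.out.pos s)
  choose ρ hρ using h
  exact ⟨ρ, fun s => by rw [← norm_pow, hρ, PadicComplex.norm_natCast_prime]⟩

/-- A non-trivial smooth character can be rescaled so that `ℤ_p` is the largest ball around `0` on
which it is trivial. -/
theorem SmoothCharacter.exists_conductor (ψ : SmoothCharacter p) (hψ : ψ.toAddChar ≠ 1) :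
    ∃ z : ℚ_[p], (∀ x, ‖x‖ ≤ 1 → ψ.toAddChar (z * x) = 1) ∧
      ψ.toAddChar (z * (p : ℚ_[p])⁻¹) ≠ 1 := by
  have hp0 : (p : ℚ_[p]) ≠ 0 := Nat.cast_ne_zero.2 hp.out.ne_zero
  obtain ⟨w, hw⟩ : ∃ w, ψ.toAddChar w ≠ 1 := by
    by_contra! h
    exact hψ (by ext x; simp [h x])
  obtain ⟨δ, hδ, hball⟩ := Metric.isOpen_iff.1 ψ.isOpen_ker 0 (by simp)
  have hex : ∃ k : ℕ, ∀ x, ‖x‖ ≤ 1 → ψ.toAddChar ((p : ℚ_[p]) ^ k * w * x) = 1 := by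
    have hlim : Filter.Tendsto (fun k : ℕ => (p : ℝ)⁻¹ ^ k * ‖w‖) Filter.atTop (nhds 0) := by
      simpa using (tendsto_pow_atTop_nhds_zero_of_lt_one (by positivity)
        (inv_lt_one_of_one_lt₀ (by exact_mod_cast hp.out.one_lt))).mul_const ‖w‖
    obtain ⟨k, hk⟩ := (hlim.eventually_lt_const hδ).exists
    refine ⟨k, fun x hx => hball ?_⟩
    rw [mem_ball_zero_iff, norm_mul, norm_mul, norm_pow, Padic.norm_p]
    exact (mul_le_of_le_one_right (by positivity) hx).trans_lt hk
  classical
  obtain ⟨k, hk⟩ : ∃ k, Nat.find hex = k + 1 := by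
    refine Nat.exists_eq_succ_of_ne_zero fun h0 => hw ?_
    have := Nat.find_spec hex 1 (by simp)
    rw [h0] at this
    simpa using this
  have h1 := Nat.find_spec hex
  have h2 := Nat.find_min hex (m := k) (by omega)
  push Not at h2
  obtain ⟨y, hy, hy'⟩ := h2
  refine ⟨(p : ℚ_[p]) ^ (k + 1) * w * y, fun x hx => ?_, ?_⟩
  · rw [mul_assoc, ← hk]
    exact h1 _ (by rw [norm_mul]; exact mul_le_one₀ hy (norm_nonneg _) hx)
  · convert hy' using 2
    field_simp
    ring

/-- The indicator function of a ball around `0` in `ℚ_p` is, on any larger ball and up to a scalar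
of norm close to `1`, a uniform limit of combinations of characters with integral coefficients. -/
theorem SmoothCharacter.exists_mem_charRing_norm_sub_le (ψ : SmoothCharacter p)
    (hψ : ψ.toAddChar ≠ 1) {ρ : ℕ → ℂ_[p]} (hρ : ∀ s, ‖ρ s‖ ^ p ^ s = (p : ℝ)⁻¹) (k n R : ℕ)
    {ε : ℝ} (hε : 0 < ε) :
    ∃ b ∈ charRing ψ.toAddChar, ∀ x : ℚ_[p], ‖x‖ ≤ (p : ℝ) ^ R →
      ‖ρ k * (Metric.closedBall (0 : ℚ_[p]) ((p : ℝ)⁻¹ ^ n)).indicator 1 x - b x‖ ≤ ε := by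
  have hpR : (0 : ℝ) < p := by exact_mod_cast hp.out.pos
  obtain ⟨z, hz1, hz2⟩ := ψ.exists_conductor hψ
  set χ : AddChar ℚ_[p] ℂ_[p] := ψ.toAddChar.compAddMonoidHom (AddMonoidHom.mulLeft z) with hχ
  set φ : ℚ_[p] → ℂ_[p] :=
    (Metric.closedBall (0 : ℚ_[p]) ((p : ℝ)⁻¹ ^ (n + R))).indicator 1 with hφdef
  have hφ : IsIntegralOfLevel (n + R) φ := by
    refine ⟨fun x y _ _ hxy => ?_, fun x _ => ?_⟩
    · exact indicator_closedBall_one_eq (IsUltrametricDist.norm_le_iff_of_norm_sub_le hxy)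
    · refine (norm_indicator_le_norm_self _ _).trans ?_
      simp
  obtain ⟨b, hb, h⟩ := _root_.exists_mem_charRing_norm_sub_le (χ := χ)
    PadicComplex.norm_natCast_prime hz1 hz2 hρ k hφ hε
  have hle : charRing χ ≤ charRing ψ.toAddChar := by
    refine Subring.closure_le.2 ?_
    rintro _ ⟨c, u, hc, rfl⟩
    simpa [hχ, mul_assoc] using mul_char_mem_charRing (χ := ψ.toAddChar) hc (z * u)
  refine ⟨_, comp_mul_mem_charRing (hle hb) ((p : ℚ_[p]) ^ R), fun x hx => ?_⟩
  have hnorm : ‖(p : ℚ_[p]) ^ R * x‖ = (p : ℝ)⁻¹ ^ R * ‖x‖ := by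
    rw [norm_mul, norm_pow, Padic.norm_p]
  have hinv : (p : ℝ)⁻¹ ^ R * (p : ℝ) ^ R = 1 := by
    rw [← mul_pow, inv_mul_cancel₀ hpR.ne', one_pow]
  have hind : φ ((p : ℚ_[p]) ^ R * x)
      = (Metric.closedBall (0 : ℚ_[p]) ((p : ℝ)⁻¹ ^ n)).indicator 1 x := by
    refine indicator_closedBall_one_eq ?_
    rw [hnorm, pow_add, mul_comm (_ ^ n),
      mul_le_mul_iff_right₀ (show 0 < (p : ℝ)⁻¹ ^ R by positivity)]
  rw [← hind]
  refine h _ ?_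
  rw [hnorm, ← hinv]
  gcongr

end PadicComplex

/-! ### Schwartz functions -/

section SchwartzFunctions

variable {p : ℕ} [hp : Fact p.Prime] {d : ℕ}

theorem Schwartz.continuous (f : Schwartz p d) : Continuous f.1 := f.2.1.continuous

theorem Schwartz.norm_le_supNorm (f : Schwartz p d) (x : Qpd p d) : ‖f.1 x‖ ≤ supNorm f := by
  obtain ⟨C, hC⟩ := f.2.2.exists_bound_of_continuous (Schwartz.continuous f)
  exact le_ciSup (f := fun x => ‖f.1 x‖) ⟨C, by rintro _ ⟨y, rfl⟩; exact hC y⟩ x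

theorem Schwartz.supNorm_le {f : Schwartz p d} {M : ℝ} (h : ∀ x, ‖f.1 x‖ ≤ M) : supNorm f ≤ M :=
  ciSup_le h

theorem Schwartz.exists_norm_eq_supNorm (f : Schwartz p d) : ∃ x, ‖f.1 x‖ = supNorm f := by
  obtain ⟨x, hx⟩ := (Schwartz.continuous f).norm.exists_forall_ge_of_hasCompactSupport f.2.2.norm
  exact ⟨x, le_antisymm (Schwartz.norm_le_supNorm f x) (Schwartz.supNorm_le hx)⟩

theorem Schwartz.exists_support_bound (f : Schwartz p d) :
    ∃ R : ℕ, ∀ x, f.1 x ≠ 0 → ‖x‖ ≤ (p : ℝ) ^ R := by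
  obtain ⟨M, hM⟩ := f.2.2.isCompact.isBounded.subset_closedBall 0
  obtain ⟨R, hR⟩ := pow_unbounded_of_one_lt M (show (1 : ℝ) < p by exact_mod_cast hp.out.one_lt)
  refine ⟨R, fun x hx => ?_⟩
  have := hM (subset_tsupport _ hx)
  rw [mem_closedBall_zero_iff] at this
  exact this.trans hR.le

/-- A Schwartz function is uniformly locally constant. -/
theorem Schwartz.exists_level (f : Schwartz p d) :
    ∃ n₀ : ℕ, ∀ n, n₀ ≤ n → ∀ x y, ‖x - y‖ ≤ (p : ℝ)⁻¹ ^ n → f.1 x = f.1 y := by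
  obtain ⟨R, hR⟩ := Schwartz.exists_support_bound f
  have hp1 : (1 : ℝ) < p := by exact_mod_cast hp.out.one_lt
  have hinv : (p : ℝ)⁻¹ ≤ 1 := inv_le_one_of_one_le₀ hp1.le
  obtain ⟨δ, hδ, h⟩ := lebesgue_number_lemma_of_metric
    (isCompact_closedBall (0 : Qpd p d) ((p : ℝ) ^ R)) (c := fun v : ℂ_[p] => f.1 ⁻¹' {v})
    (fun v => f.2.1.isOpen_fiber v) (fun x _ => Set.mem_iUnion.2 ⟨f.1 x, rfl⟩)
  obtain ⟨n₀, hn₀⟩ := exists_pow_lt_of_lt_one hδ (inv_lt_one_of_one_lt₀ hp1)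
  refine ⟨n₀, fun n hn x y hxy => ?_⟩
  have hxy' : ‖x - y‖ < δ :=
    (hxy.trans (pow_le_pow_of_le_one (by positivity) hinv hn)).trans_lt hn₀
  by_cases hx : ‖x‖ ≤ (p : ℝ) ^ R
  · obtain ⟨v, hv⟩ := h x (mem_closedBall_zero_iff.2 hx)
    have h1 : f.1 x = v := hv (Metric.mem_ball_self hδ)
    have h2 : f.1 y = v := hv (by rwa [Metric.mem_ball, dist_comm, dist_eq_norm])
    rw [h1, h2]
  · have hy : ¬ ‖y‖ ≤ (p : ℝ) ^ R := by
      refine (not_congr (IsUltrametricDist.norm_le_iff_of_norm_sub_le (hxy.trans ?_))).1 hx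
      exact (pow_le_one₀ (by positivity) hinv).trans (one_le_pow₀ hp1.le)
    have h0 : ∀ z, ¬ ‖z‖ ≤ (p : ℝ) ^ R → f.1 z = 0 := fun z hz => by
      by_contra hne
      exact hz (hR z hne)
    rw [h0 x hx, h0 y hy]

/-- The product of a Schwartz function with the indicator function of a clopen set. -/
noncomputable def Schwartz.restrict (f : Schwartz p d) {U : Set (Qpd p d)} (hU : IsClopen U) :
    Schwartz p d :=
  ⟨fun x => U.indicator 1 x * f.1 x, by
    refine ⟨IsLocallyConstant.mul ?_ f.2.1, f.2.2.mul_left⟩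
    rw [← LocallyConstant.coe_charFn ℂ_[p] hU]
    exact (LocallyConstant.charFn ℂ_[p] hU).isLocallyConstant⟩

theorem isClopen_norm_apply_le (i : Fin d) {r : ℝ} (hr : r ≠ 0) :
    IsClopen {x : Qpd p d | ‖x i‖ ≤ r} := by
  have : {x : Qpd p d | ‖x i‖ ≤ r} = (fun x => x i) ⁻¹' Metric.closedBall 0 r := by
    ext x
    simp
  rw [this]
  exact (IsUltrametricDist.isClopen_closedBall _ hr).preimage (continuous_apply i)

/-- The indicator function of the polydisc `p ^ n ℤ_p^d`. -/
noncomputable def charBall (p : ℕ) [Fact p.Prime] (d n : ℕ) : Schwartz p d :=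
  ⟨(Metric.closedBall 0 ((p : ℝ)⁻¹ ^ n)).indicator 1, by
    have hr : (p : ℝ)⁻¹ ^ n ≠ 0 :=
      pow_ne_zero _ (inv_ne_zero (Nat.cast_ne_zero.2 (Fact.out : p.Prime).ne_zero))
    have hcl := IsUltrametricDist.isClopen_closedBall (0 : Qpd p d) hr
    refine ⟨?_, ?_⟩
    · rw [← LocallyConstant.coe_charFn ℂ_[p] hcl]
      exact (LocallyConstant.charFn ℂ_[p] hcl).isLocallyConstant
    · exact HasCompactSupport.intro (isCompact_closedBall _ _)
        fun x hx => Set.indicator_of_notMem hx _⟩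

theorem charBall_apply_of_le {n : ℕ} {x : Qpd p d} (hx : ‖x‖ ≤ (p : ℝ)⁻¹ ^ n) :
    (charBall p d n).1 x = 1 :=
  Set.indicator_of_mem (mem_closedBall_zero_iff.2 hx) _

theorem charBall_apply_of_not_le {n : ℕ} {x : Qpd p d} (hx : ¬ ‖x‖ ≤ (p : ℝ)⁻¹ ^ n) :
    (charBall p d n).1 x = 0 :=
  Set.indicator_of_notMem (fun h => hx (mem_closedBall_zero_iff.1 h)) _

theorem charBall_zero : charBall p d 0 = charZp p d := by
  ext x
  simp [charBall, charZp, unitPolydisc_eq]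

@[simp] theorem schrodinger_apply (ψ : SmoothCharacter p) (h : Heis p d) (f : Schwartz p d)
    (x : Qpd p d) : (schrodinger d ψ h f).1 x
      = ψ.toAddChar (h.t + (h.a ⬝ᵥ h.b) / 2 + h.b ⬝ᵥ x) * f.1 (x + h.a) := rfl

end SchwartzFunctions

/-! ### Invariant norms dominated by the sup norm -/

section InvariantNorms

variable {p : ℕ} [hp : Fact p.Prime] {d : ℕ} {ψ : SmoothCharacter p} {N : Schwartz p d → ℝ}

theorem IsNANorm.map_neg {V : Type*} [AddCommGroup V] [Module ℂ_[p] V] {N : V → ℝ}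
    (hN : IsNANorm (p := p) N) (v : V) : N (-v) = N v := by
  simpa using hN.smul (-1) v

/-- Multiplication by an integral combination of characters of one coordinate does not increase
an invariant norm. -/
theorem IsInvariantNorm.exists_mul_charRing (hN : IsInvariantNorm ψ N) (i : Fin d)
    {b : ℚ_[p] → ℂ_[p]} (hb : b ∈ charRing ψ.toAddChar) (f : Schwartz p d) :
    ∃ g : Schwartz p d, (∀ x, g.1 x = b (x i) * f.1 x) ∧ N g ≤ N f := by
  induction hb using Subring.closure_induction generalizing f with
  | mem b hb =>
    obtain ⟨c, u, hc, rfl⟩ := hb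
    refine ⟨c • schrodinger d ψ ⟨0, Pi.single i u, 0⟩ f, fun x => ?_, ?_⟩
    · change c * (schrodinger d ψ _ f).1 x = _
      rw [schrodinger_apply]
      simp [mul_assoc]
    · rw [hN.isNANorm.smul, hN.invariant]
      exact mul_le_of_le_one_left (hN.isNANorm.nonneg _) hc
  | zero => exact ⟨0, fun x => by simp, by
      rw [(hN.isNANorm.eq_zero_iff 0).2 rfl]; exact hN.isNANorm.nonneg f⟩
  | one => exact ⟨f, fun x => by simp, le_rfl⟩
  | add b b' _ _ hb hb' =>
    obtain ⟨g, hg, hgN⟩ := hb f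
    obtain ⟨g', hg', hgN'⟩ := hb' f
    refine ⟨g + g', fun x => ?_, (hN.isNANorm.add_le_max _ _).trans (max_le hgN hgN')⟩
    change g.1 x + g'.1 x = _
    rw [hg, hg', Pi.add_apply, add_mul]
  | neg b _ hb =>
    obtain ⟨g, hg, hgN⟩ := hb f
    refine ⟨-g, fun x => ?_, (hN.isNANorm.map_neg g).trans_le hgN⟩
    change -g.1 x = _
    rw [hg, Pi.neg_apply, neg_mul]
  | mul b b' _ _ hb hb' =>
    obtain ⟨g', hg', hgN'⟩ := hb' f
    obtain ⟨g, hg, hgN⟩ := hb g'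
    exact ⟨g, fun x => by rw [hg, hg', Pi.mul_apply, mul_assoc], hgN.trans hgN'⟩

theorem inv_prime_pow_ne_zero (n : ℕ) : (p : ℝ)⁻¹ ^ n ≠ 0 :=
  pow_ne_zero _ (inv_ne_zero (Nat.cast_ne_zero.2 hp.out.ne_zero))

/-- Cutting a function off in one coordinate does not increase an invariant norm dominated by the
sup norm: the cut-off is multiplication by a uniform limit of combinations of characters. -/
theorem IsInvariantNorm.map_restrict_le (hψ : ψ.toAddChar ≠ 1) (hN : IsInvariantNorm ψ N)
    (hD : NormDominated N supNorm) (f : Schwartz p d) (i : Fin d) (n : ℕ) :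
    N (Schwartz.restrict f (isClopen_norm_apply_le i (inv_prime_pow_ne_zero (p := p) n))) ≤ N f := by
  set F := Schwartz.restrict f (isClopen_norm_apply_le i (inv_prime_pow_ne_zero (p := p) n)) with hF
  obtain ⟨D, hD0, hD⟩ := hD
  obtain ⟨ρ, hρ⟩ := PadicComplex.exists_norm_pow_eq (p := p)
  obtain ⟨R, hR⟩ := Schwartz.exists_support_bound f
  have hNf := hN.isNANorm.nonneg f
  have hs : 0 ≤ supNorm f := (norm_nonneg _).trans (Schwartz.norm_le_supNorm f 0)
  have h1 : ∀ k, ∀ ε > 0, ‖ρ k‖ * N F ≤ max (N f) (D * (ε * supNorm f)) := by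
    intro k ε hε
    obtain ⟨b, hb, hbε⟩ := ψ.exists_mem_charRing_norm_sub_le hψ hρ k n R hε
    obtain ⟨g, hg, hgN⟩ := hN.exists_mul_charRing i hb f
    have hsup : supNorm (ρ k • F - g) ≤ ε * supNorm f := by
      refine Schwartz.supNorm_le fun x => ?_
      have hFx : F.1 x
          = (Metric.closedBall (0 : ℚ_[p]) ((p : ℝ)⁻¹ ^ n)).indicator 1 (x i) * f.1 x := by
        change ({x : Qpd p d | ‖x i‖ ≤ _}).indicator 1 x * f.1 x = _
        congr 1
        classical
        simp only [Set.indicator_apply, mem_closedBall_zero_iff, Pi.one_apply, Set.mem_ofPred_eq]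
      have e : (ρ k • F - g).1 x = (ρ k *
          (Metric.closedBall (0 : ℚ_[p]) ((p : ℝ)⁻¹ ^ n)).indicator 1 (x i) - b (x i)) * f.1 x := by
        change ρ k * F.1 x - g.1 x = _
        rw [hFx, hg]
        ring
      rw [e, norm_mul]
      by_cases hx : f.1 x = 0
      · rw [hx, norm_zero, mul_zero]
        positivity
      · exact mul_le_mul (hbε _ ((norm_le_pi_norm x i).trans (hR x hx)))
          (Schwartz.norm_le_supNorm f x) (norm_nonneg _) hε.le
    rw [← hN.isNANorm.smul]
    have := hN.isNANorm.add_le_max g (ρ k • F - g)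
    rw [add_sub_cancel] at this
    exact this.trans (max_le_max hgN ((hD _).trans (by gcongr)))
  have h2 : ∀ k, ‖ρ k‖ * N F ≤ N f := by
    intro k
    by_contra! h
    have h3 : ∀ ε > 0, ‖ρ k‖ * N F ≤ ε * (D * supNorm f) := fun ε hε => by
      have := (le_max_iff.1 (h1 k ε hε)).resolve_left (not_le.2 h)
      linarith
    have hlim : Filter.Tendsto (fun ε : ℝ => ε * (D * supNorm f)) (nhdsWithin 0 (Set.Ioi 0))
        (nhds 0) := by
      have : Filter.Tendsto (fun ε : ℝ => ε * (D * supNorm f)) (nhds 0)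
          (nhds (0 * (D * supNorm f))) := Filter.tendsto_id.mul_const _
      rw [zero_mul] at this
      exact this.mono_left nhdsWithin_le_nhds
    have := ge_of_tendsto hlim (eventually_mem_nhdsWithin.mono h3)
    linarith
  -- `‖ρ k‖ = p ^ (-1 / p ^ k)` is eventually larger than any number below `1`
  by_contra! h
  have hF0 : 0 < N F := hNf.trans_lt h
  obtain ⟨m, hm⟩ := exists_pow_lt_of_lt_one (show (0 : ℝ) < (p : ℝ)⁻¹ from
    inv_pos.2 (by exact_mod_cast hp.out.pos)) ((div_lt_one hF0).2 h)
  have h3 : ‖ρ m‖ ≤ N f / N F := (le_div_iff₀ hF0).2 (h2 m)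
  have h4 : (p : ℝ)⁻¹ ≤ (N f / N F) ^ p ^ m := by
    rw [← hρ m]
    gcongr
  have h5 : (N f / N F) ^ p ^ m ≤ (N f / N F) ^ m :=
    pow_le_pow_of_le_one (by positivity) ((div_lt_one hF0).2 h).le (Nat.lt_pow_self hp.out.one_lt).le
  linarith

/-- Cutting off all coordinates replaces `f` by a multiple of the indicator function of a small
polydisc on which `f` is constant. -/
theorem IsInvariantNorm.norm_apply_zero_mul_le (hψ : ψ.toAddChar ≠ 1) (hN : IsInvariantNorm ψ N)
    (hD : NormDominated N supNorm) (f : Schwartz p d) {n : ℕ}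
    (hf : ∀ x, ‖x‖ ≤ (p : ℝ)⁻¹ ^ n → f.1 x = f.1 0) : ‖f.1 0‖ * N (charBall p d n) ≤ N f := by
  classical
  have key : ∀ s : Finset (Fin d), ∃ g : Schwartz p d,
      (∀ x, g.1 x = if ∀ i ∈ s, ‖x i‖ ≤ (p : ℝ)⁻¹ ^ n then f.1 x else 0) ∧ N g ≤ N f := by
    intro s
    induction s using Finset.induction_on with
    | empty => exact ⟨f, fun x => by simp, le_rfl⟩
    | insert i s _ ih =>
      obtain ⟨g, hg, hgN⟩ := ih
      refine ⟨_, fun x => ?_, (hN.map_restrict_le hψ hD g i n).trans hgN⟩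
      change ({x : Qpd p d | ‖x i‖ ≤ _}).indicator 1 x * g.1 x = _
      rw [hg]
      by_cases h1 : ‖x i‖ ≤ (p : ℝ)⁻¹ ^ n <;>
        simp [h1, -inv_pow]
  obtain ⟨g, hg, hgN⟩ := key Finset.univ
  have e : g = f.1 0 • charBall p d n := by
    ext x
    change g.1 x = f.1 0 * (charBall p d n).1 x
    rw [hg]
    have hiff : (∀ i ∈ Finset.univ, ‖x i‖ ≤ (p : ℝ)⁻¹ ^ n) ↔ ‖x‖ ≤ (p : ℝ)⁻¹ ^ n := by
      rw [pi_norm_le_iff_of_nonneg (by positivity)]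
      simp
    simp only [hiff]
    by_cases hx : ‖x‖ ≤ (p : ℝ)⁻¹ ^ n
    · rw [if_pos hx, charBall_apply_of_le hx, hf x hx, mul_one]
    · rw [if_neg hx, charBall_apply_of_not_le hx, mul_zero]
  rwa [← hN.isNANorm.smul, ← e]

/-- A translation moves a point where `f` has maximal absolute value to `0`. -/
theorem IsInvariantNorm.supNorm_mul_le (hψ : ψ.toAddChar ≠ 1) (hN : IsInvariantNorm ψ N)
    (hD : NormDominated N supNorm) (f : Schwartz p d) {n : ℕ}
    (hf : ∀ x y, ‖x - y‖ ≤ (p : ℝ)⁻¹ ^ n → f.1 x = f.1 y) :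
    supNorm f * N (charBall p d n) ≤ N f := by
  obtain ⟨x₀, hx₀⟩ := Schwartz.exists_norm_eq_supNorm f
  have happ : ∀ x, (schrodinger d ψ ⟨x₀, 0, 0⟩ f).1 x = f.1 (x + x₀) := fun x => by
    rw [schrodinger_apply]
    simp
  have := hN.norm_apply_zero_mul_le hψ hD (schrodinger d ψ ⟨x₀, 0, 0⟩ f) (n := n) fun x hx => by
    rw [happ, happ]
    exact hf _ _ (by simpa [-inv_pow] using hx)
  rwa [hN.invariant, happ, zero_add, hx₀] at this

/-- A Schwartz function of level `n` is a combination of translates of the indicator function of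
`p ^ n ℤ_p^d`. -/
theorem IsInvariantNorm.le_supNorm_mul (hN : IsInvariantNorm ψ N) (f : Schwartz p d) {n : ℕ}
    (hf : ∀ x y, ‖x - y‖ ≤ (p : ℝ)⁻¹ ^ n → f.1 x = f.1 y) :
    N f ≤ supNorm f * N (charBall p d n) := by
  set r := (p : ℝ)⁻¹ ^ n with hr
  classical
  have key : ∀ t : Finset (Qpd p d), ∀ f : Schwartz p d, ∀ M : ℝ, 0 ≤ M →
      (∀ x y, ‖x - y‖ ≤ r → f.1 x = f.1 y) → (∀ x, ‖f.1 x‖ ≤ M) →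
      (∀ x, f.1 x ≠ 0 → ∃ a ∈ t, ‖x - a‖ ≤ r) → N f ≤ M * N (charBall p d n) := by
    intro t
    induction t using Finset.induction_on with
    | empty =>
      intro f M hM _ _ hsupp
      have : f = 0 := by
        ext x
        by_contra hx
        simpa using hsupp x hx
      rw [this, (hN.isNANorm.eq_zero_iff 0).2 rfl]
      exact mul_nonneg hM (hN.isNANorm.nonneg _)
    | insert a t _ ih =>
      intro f M hM hlev hbd hsupp
      set c : Schwartz p d := schrodinger d ψ ⟨-a, 0, 0⟩ (charBall p d n) with hc
      have hcx : ∀ x, c.1 x = (charBall p d n).1 (x - a) := fun x => by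
        rw [hc, schrodinger_apply]
        simp [sub_eq_add_neg]
      set h : Schwartz p d := f - f.1 a • c with hh
      have hhx : ∀ x, h.1 x = f.1 x - f.1 a * c.1 x := fun x => rfl
      have hin : ∀ x, ‖x - a‖ ≤ r → h.1 x = 0 := fun x hx => by
        rw [hhx, hcx, charBall_apply_of_le hx, hlev x a hx, mul_one, sub_self]
      have hout : ∀ x, ¬ ‖x - a‖ ≤ r → h.1 x = f.1 x := fun x hx => by
        rw [hhx, hcx, charBall_apply_of_not_le hx, mul_zero, sub_zero]
      have h1 : N h ≤ M * N (charBall p d n) := by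
        refine ih h M hM ?_ ?_ ?_
        · intro x y hxy
          have hiff : ‖x - a‖ ≤ r ↔ ‖y - a‖ ≤ r :=
            IsUltrametricDist.norm_le_iff_of_norm_sub_le (by rwa [sub_sub_sub_cancel_right])
          by_cases hx : ‖x - a‖ ≤ r
          · rw [hin x hx, hin y (hiff.1 hx)]
          · rw [hout x hx, hout y (hiff.not.1 hx), hlev x y hxy]
        · intro x
          by_cases hx : ‖x - a‖ ≤ r
          · rw [hin x hx, norm_zero]
            exact hM
          · rw [hout x hx]
            exact hbd x
        · intro x hx
          have hx' : ¬ ‖x - a‖ ≤ r := fun h' => hx (hin x h')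
          rw [hout x hx'] at hx
          obtain ⟨b, hb, hxb⟩ := hsupp x hx
          obtain rfl | hb := Finset.mem_insert.1 hb
          · exact absurd hxb hx'
          · exact ⟨b, hb, hxb⟩
      have h2 := hN.isNANorm.add_le_max h (f.1 a • c)
      rw [hh, sub_add_cancel, ← hh, hN.isNANorm.smul, hc, hN.invariant] at h2
      exact h2.trans (max_le h1 (mul_le_mul_of_nonneg_right (hbd a) (hN.isNANorm.nonneg _)))
  obtain ⟨t, -, ht, hcov⟩ := f.2.2.isCompact.finite_cover_balls (e := r)
    (pow_pos (inv_pos.2 (by exact_mod_cast hp.out.pos)) n)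
  refine key ht.toFinset f (supNorm f) ((norm_nonneg _).trans (Schwartz.norm_le_supNorm f 0)) hf
    (Schwartz.norm_le_supNorm f) fun x hx => ?_
  obtain ⟨a, ha, hxa⟩ := Set.mem_iUnion₂.1 (hcov (subset_tsupport _ hx))
  exact ⟨a, ht.mem_toFinset.2 ha, by
    rw [← dist_eq_norm]
    exact (Metric.mem_ball.1 hxa).le⟩

theorem supNorm_charZp : supNorm (charZp p d) = 1 := by
  rw [← charBall_zero]
  refine le_antisymm (Schwartz.supNorm_le fun x => ?_) ?_
  · refine (norm_indicator_le_norm_self _ _).trans ?_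
    simp
  · have := Schwartz.norm_le_supNorm (charBall p d 0) 0
    rwa [charBall_apply_of_le (by simp), norm_one] at this

/-- For all large `n`, both `N f` and `N (charZp p d)` are computed by the norm of the indicator
function of `p ^ n ℤ_p^d`, so the latter does not depend on `n`. -/
theorem IsInvariantNorm.eq_mul_supNorm (hψ : ψ.toAddChar ≠ 1) (hN : IsInvariantNorm ψ N)
    (hD : NormDominated N supNorm) (f : Schwartz p d) : N f = N (charZp p d) * supNorm f := by
  have key : ∀ f : Schwartz p d, ∃ n₀, ∀ n, n₀ ≤ n → N f = supNorm f * N (charBall p d n) := by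
    intro f
    obtain ⟨n₀, hn₀⟩ := Schwartz.exists_level f
    exact ⟨n₀, fun n hn => le_antisymm (hN.le_supNorm_mul f (hn₀ n hn))
      (hN.supNorm_mul_le hψ hD f (hn₀ n hn))⟩
  obtain ⟨n₁, h₁⟩ := key f
  obtain ⟨n₂, h₂⟩ := key (charZp p d)
  rw [h₁ _ (le_max_left n₁ n₂), h₂ _ (le_max_right n₁ n₂), supNorm_charZp, one_mul, mul_comm]

theorem IsInvariantNorm.exists_pos_eq_mul_supNorm (hψ : ψ.toAddChar ≠ 1)
    (hN : IsInvariantNorm ψ N) (hD : NormDominated N supNorm) :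
    ∃ r : ℝ, 0 < r ∧ ∀ f, N f = r * supNorm f := by
  refine ⟨N (charZp p d), (hN.isNANorm.nonneg _).lt_of_ne fun h => ?_, hN.eq_mul_supNorm hψ hD⟩
  have h0 := (hN.isNANorm.eq_zero_iff _).1 h.symm
  have h1 := supNorm_charZp (p := p) (d := d)
  rw [h0] at h1
  exact zero_ne_one ((le_antisymm (Schwartz.supNorm_le fun x => by simp)
    (h1 ▸ zero_le_one)).symm.trans h1)

/-- Transport of an invariant norm along the inverse of an intertwining operator. -/
theorem IsInvariantNorm.comp_symm (hN : IsInvariantNorm ψ N)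
    {g : symplecticGroup (Fin d) ℚ_[p]} {T : Schwartz p d ≃ₗ[ℂ_[p]] Schwartz p d}
    (hT : IsIntertwining ψ g T) : IsInvariantNorm ψ fun f => N (T.symm f) where
  isNANorm :=
    { nonneg := fun v => hN.isNANorm.nonneg _
      eq_zero_iff := fun v => by rw [hN.isNANorm.eq_zero_iff, LinearEquiv.map_eq_zero_iff]
      smul := fun a v => by rw [map_smul, hN.isNANorm.smul]
      add_le_max := fun v w => by rw [map_add]; exact hN.isNANorm.add_le_max _ _ }
  invariant := fun h f => by
    have := hT h (T.symm f)
    rw [LinearEquiv.apply_symm_apply] at this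
    rw [this, LinearEquiv.symm_apply_apply, hN.invariant]

end InvariantNorms

theorem mainTheorem1 (p : ℕ) [Fact p.Prime] (d : ℕ) (hd : 1 ≤ d)
    (ψ : SmoothCharacter p) (hψ : ψ.toAddChar ≠ 1) :
    (∀ (α : Grassmannian p d) (Nα : Schwartz p d → ℝ), IsGrassmannianNorm ψ α Nα →
      ∀ N : Schwartz p d → ℝ, IsInvariantNorm ψ N → NormDominated N Nα →
        ∃ r : ℝ, 0 < r ∧ ∀ f, N f = r * Nα f) ∧
    (∀ N : Schwartz p d → ℝ, IsInvariantNorm ψ N → NormDominated N supNorm →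
        ∃ r : ℝ, 0 < r ∧ ∀ f, N f = r * supNorm f) := by
  refine ⟨?_, fun N hN hD => hN.exists_pos_eq_mul_supNorm hψ hD⟩
  intro α Nα hα N hN hD
  obtain ⟨g, -, T, hT, c, hc, hNα⟩ := hα.homothetic
  obtain ⟨D, hD0, hD⟩ := hD
  obtain ⟨r, hr, h⟩ := (hN.comp_symm hT).exists_pos_eq_mul_supNorm hψ ⟨D * c, mul_pos hD0 hc,
    fun f => (hD _).trans_eq (by simp only [hNα, LinearEquiv.apply_symm_apply, mul_assoc])⟩
  refine ⟨r / c, div_pos hr hc, fun f => ?_⟩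
  have := h (T f)
  rw [LinearEquiv.symm_apply_apply] at this
  rw [this, hNα]
  field_simp
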